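/- Let $X$ be a real random variable with finite variance $\sigma_X^2$, let $a\in\mathbb R$ and $\sigma_M>0$, let $M\sim\mathcal N(0,\sigma_M^2)$ be independent of $X$, and put $Y=aX+M$. Let $N\sim\mathcal N(0,1)$ be independent of $(X,Y)$ and, for $\gamma\ge 0$, put $Z_\gamma=\sqrt{\gamma}\,Y+N$. Write $I(U;V)$ for the mutual information, $\mathrm{mmse}(U|V)=\mathbb E[(U-\mathbb E[U|V])^2]$, let $\eta_X^2(Y)=\sup_g\rho^2(Y,g(X))$ be the squared one-sided maximal correlation, where $\rho$ is the Pearson correlation coefficient (taken to be $0$ if one argument is almost surely constant) and the supremum is over all measurable $g:\mathbb R\to\mathbb R$ with $\mathbb E[g(X)^2]<\infty$, and let, for $\varepsilon\ge 0$, $$g_\varepsilon(X,Y)=\sup\{I(Y;Z_\gamma):\gamma\ge 0,\ I(X;Z_\gamma)\le\varepsilon\}\in[0,\infty]$$ be the rate-privacy function. For $0\le\varepsilon<I(X;Y)$ the supremum is finite and is a maximum. Moreover: 1. If $a^2\sigma_X^2\ge\sigma_M^2$, then $\varepsilon\mapsto g_\varepsilon(X,Y)$ is convex on $[0,\infty)$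 (as a function with values in $[0,\infty]$), hence convex and finite on $[0,I(X;Y))$. 2. If $a>0$, then for every $\varepsilon\in[0,I(X;Y))$ $$g_\varepsilon(X,Y)\ge\frac{\varepsilon}{\eta_X^2(Y)} .$$ Furthermore $$\inf_{\gamma\ge 0}\frac{\mathrm{mmse}(Y|Z_\gamma,X)}{\mathrm{mmse}(Y|Z_\gamma)}=1-\eta_X^2(Y) \qquad\text{and}\qquad \sup_{\gamma>0}\frac{I(X;Z_\gamma)}{I(Y;Z_\gamma)}=\eta_X^2(Y),$$ where $\mathrm{mmse}(Y|Z_\gamma)>0$ for all $\gamma\ge0$ and $0<I(Y;Z_\gamma)<\infty$ for all $\gamma>0$. -/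

import Mathlib

open MeasureTheory ProbabilityTheory
open scoped ENNReal NNReal

namespace RatePrivacy

noncomputable section

variable {Ω : Type*} [MeasurableSpace Ω]

/-- Mutual information `I(U; V) = D(P_{UV} ‖ P_U ⊗ P_V)` (in nats), with values in `[0, ∞]`. -/
def mutualInfo {α β : Type*} [MeasurableSpace α] [MeasurableSpace β]
    (U : Ω → α) (V : Ω → β) (P : Measure Ω) : ℝ≥0∞ :=
  InformationTheory.klDiv (P.map fun ω => (U ω, V ω)) ((P.map U).prod (P.map V))

/-- `mmse(U | V) = E[(U - E[U | V])²]`, where `E[U | V]` is the conditional expectation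
of `U` given the σ-algebra generated by `V`. -/
def mmse {β : Type*} [MeasurableSpace β] (U : Ω → ℝ) (V : Ω → β) (P : Measure Ω) : ℝ :=
  ∫ ω, (U ω - (P[U | MeasurableSpace.comap V inferInstance]) ω) ^ 2 ∂P

/-- The squared Pearson correlation coefficient `ρ²(U, W)` of square-integrable `U`, `W`
(equal to `0` if one of them is almost surely constant). -/
def corrSq (U W : Ω → ℝ) (P : Measure Ω) : ℝ :=
  cov[U, W; P] ^ 2 / (Var[U; P] * Var[W; P])

/-- The squared one-sided maximal correlation `η_V²(U) = sup_g ρ²(U, g(V))`, the supremum being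
over all measurable `g` for which `g(V)` is square-integrable. -/
def etaSq {β : Type*} [MeasurableSpace β] (V : Ω → β) (U : Ω → ℝ) (P : Measure Ω) : ℝ :=
  sSup {r : ℝ | ∃ g : β → ℝ, Measurable g ∧ MemLp (fun ω => g (V ω)) 2 P ∧
    r = corrSq U (fun ω => g (V ω)) P}

/-- The output `Z_γ = √γ Y + N` of the additive noise channel with input `Y` and noise `N`. -/
def chanOut (Y N : Ω → ℝ) (γ : ℝ) : Ω → ℝ := fun ω => √γ * Y ω + N ω

/-- The rate-privacy function `g_ε(X, Y)`: the supremum of `I(Y; Z_γ)` over all `γ ≥ 0`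
with `I(X; Z_γ) ≤ ε`, where `Z_γ = √γ Y + N`. -/
def ratePrivacy (X Y N : Ω → ℝ) (P : Measure Ω) (ε : ℝ≥0) : ℝ≥0∞ :=
  sSup ((fun γ : ℝ => mutualInfo Y (chanOut Y N γ) P) ''
    {γ : ℝ | 0 ≤ γ ∧ mutualInfo X (chanOut Y N γ) P ≤ ε})

end

end RatePrivacy

/-!
Everything is expressed through the law `μ` of the channel input. For `s ≥ 0` the output of the
Gaussian channel `s Y + N` has density `normalizer μ s / √(2π)`, and `channelInfo μ s` and
`channelMMSE μ s` are the mutual information `I(Y; s Y + N)` and the error `mmse(Y | s Y + N)`. Since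
`√γ Y + N = √γ a X + (√γ M + N)` with Gaussian `√γ M + N` independent of `X`, the mutual informations
`F(γ) = I(Y; Z_γ)`, `G(γ) = I(X; Z_γ)` and `I(X; Y)` are all of the form `channelInfo`
(`mutualInfo_gaussian_channel`). They are therefore finite and continuous, and `G(γ) → I(X; Y)` as
`γ → ∞` (`tendsto_leakage`). Each of them is the entropy of the output minus the entropy of the noise,
so that with `v = σ_M²` one has `G(γ) = F(γ) - ½ log (1 + γ v)` (`leakage_eq_sub`).

The analytic core is the I-MMSE relation `F' = m / 2`, `m(γ) = mmse(Y | Z_γ)`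
(`hasDerivAt_channelInfo`). It is obtained by differentiating `E[log normalizer]` along the paths
`s ↦ s Y + N`; the domination uses that the posterior second moment of the noise is at most its prior
second moment, and the expectation of the derivative is computed with the tower property alone.
Writing `l(γ) = mmse(Y | Z_γ, X) = v / (1 + γ v)`, one obtains `G' = (m - l) / 2 ≥ 0`.

Adding a second independent observation and estimating linearly shows that `1 / m(γ) - γ` is
nondecreasing (`channelMMSE_le_div`), while `1 / l(γ) - γ` is constant. Together with `l ≤ m` this
makes `l / m`, hence `F' / G' = 1 / (1 - l / m)`, nondecreasing, which by Cauchy's mean value theorem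
is the convexity of `F ∘ G⁻¹` (`convexOn_maxGain`). It also shows that `l / m` is smallest at `γ = 0`,
where it equals `v / Var Y = 1 - η²` (`etaSq_channel`). Integrating `G' ≤ η² F'` gives `G ≤ η² F`.
The constant `η²` is optimal because `F(γ) ≥ γ m(γ) / 2` and `m(γ) → Var Y` as `γ → 0`, by Fatou's
lemma (`variance_le_of_channelMMSE_le`).
-/

namespace RatePrivacy

open Filter Topology

/-! ### Posterior averages of the Gaussian channel -/

/-- The likelihood `exp (-(z - s y)² / 2)` of the input `y` given the output `z` of the channel
`z = s y + n` with standard Gaussian noise `n`, up to the factor `√(2π)`. -/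
noncomputable def gweight (s z y : ℝ) : ℝ := Real.exp (-(z - s * y) ^ 2 / 2)

/-- The total mass of the unnormalized posterior `gweight s z · μ`. Up to the factor `√(2π)`, this
is the density of the channel output at `z` when the input has law `μ`. -/
noncomputable def normalizer (μ : Measure ℝ) (s z : ℝ) : ℝ := ∫ y, gweight s z y ∂μ

/-- The posterior expectation `E[g(Y) | s Y + N = z]`, for `Y ∼ μ` and `N ∼ 𝒩(0, 1)` independent. -/
noncomputable def postAvg (μ : Measure ℝ) (s : ℝ) (g : ℝ → ℝ) (z : ℝ) : ℝ :=
  (∫ y, g y * gweight s z y ∂μ) / normalizer μ s z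

lemma gweight_pos (s z y : ℝ) : 0 < gweight s z y := Real.exp_pos _

lemma gweight_le_one (s z y : ℝ) : gweight s z y ≤ 1 :=
  Real.exp_le_one_iff.2 (by nlinarith [sq_nonneg (z - s * y)])

@[fun_prop]
lemma continuous_gweight : Continuous fun p : ℝ × ℝ × ℝ => gweight p.1 p.2.1 p.2.2 := by
  unfold gweight; fun_prop

@[fun_prop]
lemma Continuous.gweight {α : Type*} [TopologicalSpace α] {f g h : α → ℝ} (hf : Continuous f)
    (hg : Continuous g) (hh : Continuous h) :
    Continuous fun x => gweight (f x) (g x) (h x) :=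
  continuous_gweight.comp (hf.prodMk (hg.prodMk hh))

section

variable {μ : Measure ℝ}

lemma integrable_mul_gweight {g : ℝ → ℝ} (hg : Integrable g μ) (s z : ℝ) :
    Integrable (fun y => g y * gweight s z y) μ := by
  refine hg.mul_bdd (c := 1) (by fun_prop) (ae_of_all _ fun y => ?_)
  rw [Real.norm_of_nonneg (gweight_pos _ _ _).le]
  exact gweight_le_one _ _ _

lemma continuous_integral_mul_gweight {g : ℝ → ℝ} (hg : Integrable g μ) :
    Continuous fun p : ℝ × ℝ => ∫ y, g y * gweight p.1 p.2 y ∂μ := by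
  refine continuous_of_dominated (bound := fun y => ‖g y‖)
    (fun p => (integrable_mul_gweight hg _ _).aestronglyMeasurable) (fun p => ae_of_all _ fun y => ?_)
    hg.norm (ae_of_all _ fun y => by fun_prop)
  rw [norm_mul, Real.norm_of_nonneg (gweight_pos _ _ _).le]
  exact mul_le_of_le_one_right (norm_nonneg _) (gweight_le_one _ _ _)

lemma postAvg_add {f g : ℝ → ℝ} (hf : Integrable f μ) (hg : Integrable g μ) (s z : ℝ) :
    postAvg μ s (fun y => f y + g y) z = postAvg μ s f z + postAvg μ s g z := by
  simp only [postAvg, add_mul]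
  rw [integral_add (integrable_mul_gweight hf s z) (integrable_mul_gweight hg s z), add_div]

lemma postAvg_const_mul (c : ℝ) (f : ℝ → ℝ) (s z : ℝ) :
    postAvg μ s (fun y => c * f y) z = c * postAvg μ s f z := by
  simp only [postAvg, mul_assoc]
  rw [integral_const_mul, mul_div_assoc]

variable [IsProbabilityMeasure μ]

lemma integrable_gweight (s z : ℝ) : Integrable (gweight s z) μ := by
  simpa using integrable_mul_gweight (μ := μ) (integrable_const (1 : ℝ)) s z

lemma normalizer_pos (s z : ℝ) : 0 < normalizer μ s z :=
  integral_exp_pos (integrable_gweight s z)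

lemma normalizer_le_one (s z : ℝ) : normalizer μ s z ≤ 1 := by
  calc normalizer μ s z ≤ ∫ _, (1 : ℝ) ∂μ :=
        integral_mono (integrable_gweight s z) (integrable_const 1) (gweight_le_one s z)
    _ = 1 := by simp

lemma continuous_normalizer : Continuous fun p : ℝ × ℝ => normalizer μ p.1 p.2 := by
  simpa [normalizer] using continuous_integral_mul_gweight (μ := μ) (integrable_const (1 : ℝ))

@[fun_prop]
lemma Continuous.normalizer {α : Type*} [TopologicalSpace α] {f g : α → ℝ} (hf : Continuous f)
    (hg : Continuous g) : Continuous fun x => normalizer μ (f x) (g x) :=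
  continuous_normalizer.comp (hf.prodMk hg)

lemma continuous_postAvg {g : ℝ → ℝ} (hg : Integrable g μ) :
    Continuous fun p : ℝ × ℝ => postAvg μ p.1 g p.2 :=
  (continuous_integral_mul_gweight hg).div continuous_normalizer fun _ => (normalizer_pos _ _).ne'

lemma postAvg_one (s z : ℝ) : postAvg μ s (fun _ => 1) z = 1 := by
  simp only [postAvg, one_mul]
  exact div_self (normalizer_pos s z).ne'

lemma postAvg_const (c s z : ℝ) : postAvg μ s (fun _ => c) z = c := by
  simpa [postAvg_one] using postAvg_const_mul (μ := μ) c (fun _ => 1) s z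

lemma postAvg_mono {f g : ℝ → ℝ} (hf : Integrable f μ) (hg : Integrable g μ) (h : ∀ y, f y ≤ g y)
    (s z : ℝ) : postAvg μ s f z ≤ postAvg μ s g z := by
  refine div_le_div_of_nonneg_right ?_ (normalizer_pos s z).le
  exact integral_mono (integrable_mul_gweight hf s z) (integrable_mul_gweight hg s z) fun y =>
    mul_le_mul_of_nonneg_right (h y) (gweight_pos s z y).le

lemma sq_postAvg_le {f : ℝ → ℝ} (hf : Integrable f μ) (hf2 : Integrable (fun y => f y ^ 2) μ)
    (s z : ℝ) : postAvg μ s f z ^ 2 ≤ postAvg μ s (fun y => f y ^ 2) z := by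
  set c := postAvg μ s f z with hc
  -- the variance of the posterior is nonnegative
  have h := postAvg_mono (μ := μ) (f := fun _ => -c ^ 2) (g := fun y => f y ^ 2 + (-2 * c) * f y)
    (integrable_const _) (hf2.add (hf.const_mul _)) (fun y => by nlinarith [sq_nonneg (f y - c)]) s z
  rw [postAvg_const, postAvg_add hf2 (hf.const_mul _), postAvg_const_mul, ← hc] at h
  linarith

end

/-- The second moment of a measure on the line. -/
noncomputable def secondMoment (μ : Measure ℝ) : ℝ := ∫ y, y ^ 2 ∂μ

section

variable {μ : Measure ℝ}

lemma integrable_sq_of_memLp (hμ : MemLp id 2 μ) : Integrable (fun y : ℝ => y ^ 2) μ :=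
  hμ.integrable_sq

lemma secondMoment_nonneg : 0 ≤ secondMoment μ := integral_nonneg fun y => sq_nonneg y

variable [IsProbabilityMeasure μ]

lemma integrable_id_of_memLp (hμ : MemLp id 2 μ) : Integrable (fun y : ℝ => y) μ :=
  hμ.integrable one_le_two

lemma integrable_sq_affine (hμ : MemLp id 2 μ) (z s : ℝ) :
    Integrable (fun y : ℝ => (z - s * y) ^ 2) μ := by
  have : MemLp (fun y : ℝ => z - s * y) 2 μ := (memLp_const z).sub (hμ.const_mul s)
  exact this.integrable_sq

lemma integral_sq_affine_le (hμ : MemLp id 2 μ) (z s : ℝ) :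
    ∫ y, (z - s * y) ^ 2 ∂μ ≤ 2 * z ^ 2 + 2 * s ^ 2 * secondMoment μ := by
  have h2 := (integrable_sq_of_memLp hμ).const_mul (2 * s ^ 2)
  calc ∫ y, (z - s * y) ^ 2 ∂μ ≤ ∫ y, (2 * z ^ 2 + 2 * s ^ 2 * y ^ 2) ∂μ := by
        refine integral_mono (integrable_sq_affine hμ z s) ((integrable_const _).add h2) fun y => ?_
        show (z - s * y) ^ 2 ≤ 2 * z ^ 2 + 2 * s ^ 2 * y ^ 2
        nlinarith [sq_nonneg (z + s * y)]
    _ = _ := by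
        rw [integral_add (integrable_const _) h2]
        simp [secondMoment, integral_const_mul]

/-- Jensen's inequality for the exponential. -/
lemma exp_le_normalizer (hμ : MemLp id 2 μ) (s z : ℝ) :
    Real.exp (-(∫ y, (z - s * y) ^ 2 ∂μ) / 2) ≤ normalizer μ s z := by
  have hi : Integrable (fun y : ℝ => -(z - s * y) ^ 2 / 2) μ :=
    (integrable_sq_affine hμ z s).neg.div_const 2
  have := convexOn_exp.map_integral_le (μ := μ) (f := fun y : ℝ => -(z - s * y) ^ 2 / 2)
    Real.continuous_exp.continuousOn isClosed_univ (by simp) hi (integrable_gweight s z)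
  rwa [integral_div, integral_neg] at this

lemma abs_log_normalizer_le (hμ : MemLp id 2 μ) (s z : ℝ) :
    |Real.log (normalizer μ s z)| ≤ z ^ 2 + s ^ 2 * secondMoment μ := by
  have h1 := Real.log_nonpos (normalizer_pos (μ := μ) s z).le (normalizer_le_one s z)
  have h2 := Real.log_le_log (Real.exp_pos _) (exp_le_normalizer hμ s z)
  rw [Real.log_exp] at h2
  rw [abs_of_nonpos h1]
  linarith [integral_sq_affine_le hμ z s]

/-- The posterior second moment of the noise `z - s Y` is at most its prior second moment, because
the weights decrease in `(z - s y)²` (Chebyshev's correlation inequality). -/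
lemma postAvg_sq_affine_le (hμ : MemLp id 2 μ) (s z : ℝ) :
    postAvg μ s (fun y => (z - s * y) ^ 2) z ≤ ∫ y, (z - s * y) ^ 2 ∂μ := by
  set T := ∫ y, (z - s * y) ^ 2 ∂μ with hT
  have hi := integrable_sq_affine hμ z s
  rw [postAvg, div_le_iff₀ (normalizer_pos s z)]
  have key : ∀ y, ((z - s * y) ^ 2 - T) * gweight s z y
      ≤ ((z - s * y) ^ 2 - T) * Real.exp (-T / 2) := by
    intro y
    rcases le_total T ((z - s * y) ^ 2) with h | h
    · refine mul_le_mul_of_nonneg_left (Real.exp_le_exp.2 (by linarith)) (by linarith)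
    · refine mul_le_mul_of_nonpos_left (Real.exp_le_exp.2 (by linarith)) (by linarith)
  have h := integral_mono (integrable_mul_gweight (hi.sub (integrable_const T)) s z)
    ((hi.sub (integrable_const T)).mul_const _) key
  have e1 : ∫ y, ((z - s * y) ^ 2 - T) * Real.exp (-T / 2) ∂μ = 0 := by
    rw [integral_mul_const, integral_sub hi (integrable_const T)]
    simp [← hT]
  have e2 : ∫ y, ((z - s * y) ^ 2 - T) * gweight s z y ∂μ
      = ∫ y, (z - s * y) ^ 2 * gweight s z y ∂μ - T * normalizer μ s z := by
    simp only [sub_mul]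
    rw [integral_sub (integrable_mul_gweight hi s z) ((integrable_gweight s z).const_mul T),
      integral_const_mul]
    rfl
  have h' : ∫ y, ((z - s * y) ^ 2 - T) * gweight s z y ∂μ
    ≤ ∫ y, ((z - s * y) ^ 2 - T) * Real.exp (-T / 2) ∂μ := h
  rw [e1, e2] at h'
  linarith

end

/-! ### Joint law of input and output -/

/-- The joint law of input `Y ∼ μ` and output `b Y + W`, `W ∼ 𝒩(0, v)`, has the density
`(y, z) ↦ φ_v(z - b y)` with respect to `μ ⊗ dz`. -/
lemma map_prod_gaussianReal_channel (μ : Measure ℝ) [SFinite μ] (b : ℝ) {v : ℝ≥0} (hv : v ≠ 0) :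
    (μ.prod (gaussianReal 0 v)).map (fun p : ℝ × ℝ => (p.1, b * p.1 + p.2))
      = (μ.prod volume).withDensity fun p => gaussianPDF 0 v (p.2 - b * p.1) := by
  have hmeas : Measurable fun p : ℝ × ℝ => gaussianPDF 0 v (p.2 - b * p.1) :=
    (measurable_gaussianPDF 0 v).comp (by fun_prop)
  refine Measure.ext_of_lintegral _ fun f hf => ?_
  rw [lintegral_map hf (by fun_prop), lintegral_withDensity_eq_lintegral_mul _ hmeas hf,
    lintegral_prod _ (by fun_prop), lintegral_prod _ (by fun_prop)]
  refine lintegral_congr fun y => ?_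
  rw [gaussianReal_of_var_ne_zero 0 hv, lintegral_withDensity_eq_lintegral_mul _
    (measurable_gaussianPDF 0 v) (by fun_prop),
    ← lintegral_sub_right_eq_self _ (b * y)]
  simp

lemma gaussianPDFReal_sub_mul {v : ℝ≥0} (hv : v ≠ 0) (b y z : ℝ) :
    gaussianPDFReal 0 v (z - b * y)
      = (√(2 * Real.pi * v))⁻¹ * gweight (b / √v) (z / √v) y := by
  have hv' : (0 : ℝ) < v := by exact_mod_cast pos_iff_ne_zero.2 hv
  rw [gaussianPDFReal, gweight]
  congr 2
  have : z / √v - b / √v * y = (z - b * y) / √v := by ring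
  rw [this, div_pow, Real.sq_sqrt hv'.le]
  field_simp
  ring

section

variable {μ : Measure ℝ}

lemma memLp_fst (hμ : MemLp id 2 μ) :
    MemLp (fun p : ℝ × ℝ => p.1) 2 (μ.prod (gaussianReal 0 1)) := by
  simpa using hμ.comp_fst (gaussianReal 0 1)

variable [IsProbabilityMeasure μ]

lemma gaussianPDF_sub_mul_one (s y z : ℝ) :
    gaussianPDF 0 1 (z - s * y) = ENNReal.ofReal ((√(2 * Real.pi))⁻¹ * gweight s z y) := by
  rw [gaussianPDF, gaussianPDFReal_sub_mul one_ne_zero]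
  simp

lemma integrable_channel_iff (s : ℝ) {K : ℝ × ℝ → ℝ} (hK : Measurable K) :
    Integrable (fun p : ℝ × ℝ => K (p.1, s * p.1 + p.2)) (μ.prod (gaussianReal 0 1)) ↔
      Integrable (fun p : ℝ × ℝ => (√(2 * Real.pi))⁻¹ * gweight s p.2 p.1 * K p)
        (μ.prod volume) := by
  have hT : Measurable fun p : ℝ × ℝ => (p.1, s * p.1 + p.2) := by fun_prop
  have h1 := integrable_map_measure (μ := μ.prod (gaussianReal 0 1)) (g := K)
    hK.aestronglyMeasurable hT.aemeasurable
  rw [map_prod_gaussianReal_channel μ s one_ne_zero] at h1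
  have hm : Measurable fun p : ℝ × ℝ => gaussianPDF 0 1 (p.2 - s * p.1) :=
    (measurable_gaussianPDF 0 1).comp (by fun_prop)
  rw [integrable_withDensity_iff_integrable_smul' hm (ae_of_all _ fun p => gaussianPDF_lt_top)] at h1
  refine h1.symm.trans (iff_of_eq ?_)
  congr 1
  ext p
  rw [gaussianPDF_sub_mul_one, ENNReal.toReal_ofReal
    (mul_nonneg (by positivity) (gweight_pos _ _ _).le), smul_eq_mul]

lemma integral_channel (s : ℝ) {K : ℝ × ℝ → ℝ} (hK : Measurable K) :
    ∫ p, K (p.1, s * p.1 + p.2) ∂(μ.prod (gaussianReal 0 1))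
      = ∫ p, (√(2 * Real.pi))⁻¹ * gweight s p.2 p.1 * K p ∂(μ.prod volume) := by
  have hT : Measurable fun p : ℝ × ℝ => (p.1, s * p.1 + p.2) := by fun_prop
  have h1 := integral_map (μ := μ.prod (gaussianReal 0 1)) hT.aemeasurable (f := K)
    hK.aestronglyMeasurable
  rw [map_prod_gaussianReal_channel μ s one_ne_zero] at h1
  have hm : Measurable fun p : ℝ × ℝ => gaussianPDF 0 1 (p.2 - s * p.1) :=
    (measurable_gaussianPDF 0 1).comp (by fun_prop)
  rw [integral_withDensity_eq_integral_toReal_smul hm (ae_of_all _ fun p => gaussianPDF_lt_top)] at h1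
  refine h1.symm.trans (integral_congr_ae (ae_of_all _ fun p => ?_))
  dsimp only
  rw [gaussianPDF_sub_mul_one, ENNReal.toReal_ofReal
    (mul_nonneg (by positivity) (gweight_pos _ _ _).le), smul_eq_mul]

/-- The tower property: `postAvg μ s g (Z)` is a version of `E[g(Y) | Z]`, `Z = s Y + N`. -/
lemma tower_postAvg (s : ℝ) {g h : ℝ → ℝ} (hgm : Measurable g) (hg : Integrable g μ)
    (hh : Measurable h)
    (hgh : Integrable (fun p : ℝ × ℝ => g p.1 * h (s * p.1 + p.2)) (μ.prod (gaussianReal 0 1))) :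
    Integrable (fun p : ℝ × ℝ => postAvg μ s g (s * p.1 + p.2) * h (s * p.1 + p.2))
        (μ.prod (gaussianReal 0 1)) ∧
      ∫ p, postAvg μ s g (s * p.1 + p.2) * h (s * p.1 + p.2) ∂(μ.prod (gaussianReal 0 1))
        = ∫ p, g p.1 * h (s * p.1 + p.2) ∂(μ.prod (gaussianReal 0 1)) := by
  set c : ℝ := (√(2 * Real.pi))⁻¹ with hc
  have hc0 : 0 ≤ c := by positivity
  have hpm : Measurable (postAvg μ s g) := by
    have := (continuous_postAvg (μ := μ) hg).comp (Continuous.prodMk_right s)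
    exact this.measurable
  have hK1 : Measurable fun p : ℝ × ℝ => g p.1 * h p.2 := by fun_prop
  have hK2 : Measurable fun p : ℝ × ℝ => postAvg μ s g p.2 * h p.2 := by fun_prop
  have hI1 := (integrable_channel_iff (μ := μ) s hK1).1 hgh
  have hw : Measurable fun p : ℝ × ℝ => gweight s p.2 p.1 :=
    Continuous.measurable (by fun_prop)
  have inner (z : ℝ) : ∫ y, c * gweight s z y * (postAvg μ s g z * h z) ∂μ
      = ∫ y, c * gweight s z y * (g y * h z) ∂μ := by
    have e1 : ∫ y, c * gweight s z y * (postAvg μ s g z * h z) ∂μ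
        = normalizer μ s z * (c * (postAvg μ s g z * h z)) := by
      rw [normalizer, ← integral_mul_const]
      congr 1; ext y; ring
    have e2 : ∫ y, c * gweight s z y * (g y * h z) ∂μ
        = (∫ y, g y * gweight s z y ∂μ) * (c * h z) := by
      rw [← integral_mul_const]
      congr 1; ext y; ring
    rw [e1, e2, postAvg]
    have := (normalizer_pos (μ := μ) s z).ne'
    field_simp
  have hI2 : Integrable (fun p : ℝ × ℝ => c * gweight s p.2 p.1 * (postAvg μ s g p.2 * h p.2))
      (μ.prod volume) := by
    refine (integrable_prod_iff' (by fun_prop)).2 ⟨ae_of_all _ fun z => ?_, ?_⟩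
    · exact ((integrable_gweight (μ := μ) s z).const_mul c).mul_const (postAvg μ s g z * h z)
    · refine ((integrable_prod_iff' (by fun_prop)).1 hI1).2.mono' ?_ (ae_of_all _ fun z => ?_)
      · exact (AEStronglyMeasurable.norm (by fun_prop)).integral_prod_right'
          (μ := volume) (ν := μ)
          (f := fun q : ℝ × ℝ => ‖c * gweight s q.1 q.2 * (postAvg μ s g q.1 * h q.1)‖)
      · rw [Real.norm_of_nonneg (integral_nonneg fun y => norm_nonneg _)]
        have e1 : ∫ y, ‖c * gweight s z y * (postAvg μ s g z * h z)‖ ∂μ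
            = normalizer μ s z * (c * (|postAvg μ s g z| * |h z|)) := by
          rw [normalizer, ← integral_mul_const]
          congr 1; ext y
          rw [norm_mul, norm_mul, norm_mul, Real.norm_of_nonneg hc0,
            Real.norm_of_nonneg (gweight_pos s z y).le, Real.norm_eq_abs, Real.norm_eq_abs]
          ring
        have e2 : ∫ y, ‖c * gweight s z y * (g y * h z)‖ ∂μ
            = (∫ y, ‖g y * gweight s z y‖ ∂μ) * (c * |h z|) := by
          rw [← integral_mul_const]
          congr 1; ext y
          rw [norm_mul, norm_mul, norm_mul, norm_mul, Real.norm_of_nonneg hc0,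
            Real.norm_of_nonneg (gweight_pos s z y).le, Real.norm_eq_abs, Real.norm_eq_abs]
          ring
        have e3 : normalizer μ s z * |postAvg μ s g z| ≤ ∫ y, ‖g y * gweight s z y‖ ∂μ := by
          have hp := normalizer_pos (μ := μ) s z
          rw [postAvg, abs_div, abs_of_pos hp, mul_div_cancel₀ _ hp.ne']
          exact norm_integral_le_integral_norm (μ := μ) fun y => g y * gweight s z y
        dsimp only
        rw [e1, e2]
        calc normalizer μ s z * (c * (|postAvg μ s g z| * |h z|))
            = normalizer μ s z * |postAvg μ s g z| * (c * |h z|) := by ring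
          _ ≤ _ := mul_le_mul_of_nonneg_right e3 (by positivity)
  refine ⟨(integrable_channel_iff (μ := μ) s hK2).2 hI2, ?_⟩
  rw [integral_channel (μ := μ) s hK2, integral_channel (μ := μ) s hK1,
    integral_prod_symm _ hI1, integral_prod_symm _ hI2]
  exact integral_congr_ae (ae_of_all _ fun z => inner z)

/-! ### Mutual information of the Gaussian channel and its derivative -/

/-- The mutual information `I(Y; s Y + N)` for `Y ∼ μ` and `N ∼ 𝒩(0, 1)` independent, as a
function of the law `μ` and the amplitude `s`. -/
noncomputable def channelInfo (μ : Measure ℝ) (s : ℝ) : ℝ :=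
  -(1 / 2) - ∫ p, Real.log (normalizer μ s (s * p.1 + p.2)) ∂(μ.prod (gaussianReal 0 1))

/-- The minimum mean-square error `E[(Y - E[Y | s Y + N])²]` for `Y ∼ μ` and `N ∼ 𝒩(0, 1)`
independent. -/
noncomputable def channelMMSE (μ : Measure ℝ) (s : ℝ) : ℝ :=
  ∫ p, (p.1 - postAvg μ s (fun y => y) (s * p.1 + p.2)) ^ 2 ∂(μ.prod (gaussianReal 0 1))

lemma memLp_snd : MemLp (fun p : ℝ × ℝ => p.2) 2 (μ.prod (gaussianReal 0 1)) := by
  simpa using (memLp_id_gaussianReal (μ := 0) (v := 1) 2).comp_snd μ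

lemma memLp_output (hμ : MemLp id 2 μ) (s : ℝ) :
    MemLp (fun p : ℝ × ℝ => s * p.1 + p.2) 2 (μ.prod (gaussianReal 0 1)) :=
  ((memLp_fst hμ).const_mul s).add memLp_snd

lemma continuous_postMean (hμ : MemLp id 2 μ) :
    Continuous fun p : ℝ × ℝ => postAvg μ p.1 (fun y => y) p.2 :=
  continuous_postAvg (integrable_id_of_memLp hμ)

lemma measurable_postMean (hμ : MemLp id 2 μ) (s : ℝ) : Measurable (postAvg μ s fun y => y) :=
  ((continuous_postMean hμ).comp (Continuous.prodMk_right s)).measurable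

lemma postAvg_sq_integral (hμ : MemLp id 2 μ) (s : ℝ) :
    Integrable (fun p : ℝ × ℝ => postAvg μ s (fun y => y ^ 2) (s * p.1 + p.2))
        (μ.prod (gaussianReal 0 1)) ∧
      ∫ p, postAvg μ s (fun y => y ^ 2) (s * p.1 + p.2) ∂(μ.prod (gaussianReal 0 1))
        = ∫ p, p.1 ^ 2 ∂(μ.prod (gaussianReal 0 1)) := by
  have h := tower_postAvg (μ := μ) s (g := fun y => y ^ 2) (h := fun _ => 1) (by fun_prop)
    (integrable_sq_of_memLp hμ) measurable_const (by simpa using (memLp_fst hμ).integrable_sq)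
  simpa using h

lemma memLp_postMean (hμ : MemLp id 2 μ) (s : ℝ) :
    MemLp (fun p : ℝ × ℝ => postAvg μ s (fun y => y) (s * p.1 + p.2)) 2
      (μ.prod (gaussianReal 0 1)) := by
  have hm := (measurable_postMean hμ s).comp (f := fun p : ℝ × ℝ => s * p.1 + p.2) (by fun_prop)
  refine (memLp_two_iff_integrable_sq hm.aestronglyMeasurable).2 ?_
  refine (postAvg_sq_integral hμ s).1.mono' (hm.pow_const 2).aestronglyMeasurable
    (ae_of_all _ fun p => ?_)
  rw [Real.norm_of_nonneg (sq_nonneg _)]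
  exact sq_postAvg_le (integrable_id_of_memLp hμ) (integrable_sq_of_memLp hμ) s _

/-- The estimation error `Y - E[Y | Z]` is orthogonal to square-integrable functions of `Z`. -/
lemma integral_error_mul_eq_zero (hμ : MemLp id 2 μ) (s : ℝ) {h : ℝ → ℝ} (hh : Measurable h)
    (hh2 : MemLp (fun p : ℝ × ℝ => h (s * p.1 + p.2)) 2 (μ.prod (gaussianReal 0 1))) :
    ∫ p, (p.1 - postAvg μ s (fun y => y) (s * p.1 + p.2)) * h (s * p.1 + p.2)
      ∂(μ.prod (gaussianReal 0 1)) = 0 := by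
  have hi : Integrable (fun p : ℝ × ℝ => p.1 * h (s * p.1 + p.2)) (μ.prod (gaussianReal 0 1)) :=
    (memLp_fst hμ).integrable_mul hh2
  have ht := tower_postAvg (μ := μ) s (g := fun y => y) measurable_id
    (integrable_id_of_memLp hμ) hh hi
  simp only [sub_mul]
  rw [integral_sub hi ht.1, ht.2]
  exact sub_self _

/-- The posterior mean is the best mean-square estimator. -/
lemma channelMMSE_le (hμ : MemLp id 2 μ) (s : ℝ) {f : ℝ → ℝ} (hf : Measurable f)
    (hf2 : MemLp (fun p : ℝ × ℝ => f (s * p.1 + p.2)) 2 (μ.prod (gaussianReal 0 1))) :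
    channelMMSE μ s ≤ ∫ p, (p.1 - f (s * p.1 + p.2)) ^ 2 ∂(μ.prod (gaussianReal 0 1)) := by
  have he := memLp_postMean hμ s
  have h0 := integral_error_mul_eq_zero hμ s (h := fun z => postAvg μ s (fun y => y) z - f z)
    ((measurable_postMean hμ s).sub hf) (he.sub hf2)
  have i1 : Integrable (fun p : ℝ × ℝ => (p.1 - postAvg μ s (fun y => y) (s * p.1 + p.2)) ^ 2)
      (μ.prod (gaussianReal 0 1)) := ((memLp_fst hμ).sub he).integrable_sq
  have i2 : Integrable (fun p : ℝ × ℝ => (p.1 - postAvg μ s (fun y => y) (s * p.1 + p.2)) *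
      (postAvg μ s (fun y => y) (s * p.1 + p.2) - f (s * p.1 + p.2))) (μ.prod (gaussianReal 0 1)) :=
    ((memLp_fst hμ).sub he).integrable_mul (he.sub hf2)
  have i3 : Integrable (fun p : ℝ × ℝ => (p.1 - f (s * p.1 + p.2)) ^ 2)
      (μ.prod (gaussianReal 0 1)) := ((memLp_fst hμ).sub hf2).integrable_sq
  calc channelMMSE μ s
      = ∫ p, ((p.1 - postAvg μ s (fun y => y) (s * p.1 + p.2)) ^ 2 +
          2 * ((p.1 - postAvg μ s (fun y => y) (s * p.1 + p.2)) *
            (postAvg μ s (fun y => y) (s * p.1 + p.2) - f (s * p.1 + p.2))))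
          ∂(μ.prod (gaussianReal 0 1)) := by
        rw [integral_add i1 (i2.const_mul 2), integral_const_mul, h0, channelMMSE]
        ring
    _ ≤ _ := by
        refine integral_mono (i1.add (i2.const_mul 2)) i3 fun p => ?_
        dsimp only
        nlinarith [sq_nonneg (postAvg μ s (fun y => y) (s * p.1 + p.2) - f (s * p.1 + p.2))]

lemma integral_fst_sq :
    ∫ p : ℝ × ℝ, p.1 ^ 2 ∂(μ.prod (gaussianReal 0 1)) = secondMoment μ := by
  rw [integral_fun_fst (fun y : ℝ => y ^ 2)]
  simp [secondMoment]

lemma integral_snd_sq :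
    ∫ p : ℝ × ℝ, p.2 ^ 2 ∂(μ.prod (gaussianReal 0 1)) = 1 := by
  rw [integral_fun_snd (fun y : ℝ => y ^ 2)]
  have h := variance_id_gaussianReal (μ := 0) (v := 1)
  rw [variance_of_integral_eq_zero (by fun_prop) (by simp)] at h
  simpa using h

lemma integrable_log_normalizer (hμ : MemLp id 2 μ) (s : ℝ) :
    Integrable (fun p : ℝ × ℝ => Real.log (normalizer μ s (s * p.1 + p.2)))
      (μ.prod (gaussianReal 0 1)) := by
  refine ((memLp_output hμ s).integrable_sq.add
    (integrable_const (s ^ 2 * secondMoment μ))).mono' ?_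
    (ae_of_all _ fun p => abs_log_normalizer_le hμ s _)
  exact (Measurable.log (Continuous.measurable (by fun_prop))).aestronglyMeasurable

lemma continuous_channelInfo (hμ : MemLp id 2 μ) : Continuous (channelInfo μ) := by
  refine continuous_const.sub (continuous_iff_continuousAt.2 fun s₀ => ?_)
  refine continuousAt_of_dominated (bound := fun p : ℝ × ℝ =>
    2 * (|s₀| + 1) ^ 2 * p.1 ^ 2 + 2 * p.2 ^ 2 + (|s₀| + 1) ^ 2 * secondMoment μ) ?_ ?_ ?_ ?_
  · exact Eventually.of_forall fun s => (integrable_log_normalizer hμ s).aestronglyMeasurable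
  · have hs : ∀ᶠ s in 𝓝 s₀, |s| < |s₀| + 1 := continuous_abs.continuousAt.eventually_lt
      continuousAt_const (by linarith)
    filter_upwards [hs] with s hs
    refine ae_of_all _ fun p => ?_
    have h1 := abs_log_normalizer_le hμ s (s * p.1 + p.2)
    have h2 : s ^ 2 ≤ (|s₀| + 1) ^ 2 := by
      rw [← sq_abs s]
      gcongr
    rw [Real.norm_eq_abs]
    have h3 := mul_le_mul_of_nonneg_right h2 (secondMoment_nonneg (μ := μ))
    have h4 := mul_le_mul_of_nonneg_right h2 (sq_nonneg p.1)
    nlinarith [sq_nonneg (s * p.1 - p.2)]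
  · exact (((memLp_fst hμ).integrable_sq.const_mul _).add
      (memLp_snd.integrable_sq.const_mul _)).add (integrable_const _)
  · refine ae_of_all _ fun p => ContinuousAt.log ?_ (normalizer_pos _ _).ne'
    exact Continuous.continuousAt (by fun_prop)

lemma channelInfo_zero : channelInfo μ 0 = 0 := by
  have h (z : ℝ) : normalizer μ 0 z = Real.exp (-z ^ 2 / 2) := by simp [normalizer, gweight]
  simp only [channelInfo, h, Real.log_exp, zero_mul, zero_add]
  rw [integral_div, integral_neg, integral_snd_sq]
  norm_num

end

section

variable {μ : Measure ℝ} [IsProbabilityMeasure μ]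

lemma abs_mul_exp_neg_sq_le_one (t : ℝ) : |t| * Real.exp (-t ^ 2 / 2) ≤ 1 := by
  have h1 : |t| ≤ t ^ 2 / 2 + 1 := by
    have := sq_abs t
    nlinarith [sq_nonneg (|t| - 1)]
  have h2 := Real.add_one_le_exp (t ^ 2 / 2)
  rw [neg_div, Real.exp_neg, ← div_eq_mul_inv, div_le_one (Real.exp_pos _)]
  linarith

/-- Along the path `s ↦ s y + n` of the channel output, the derivative of the normalizer is
`-∫ (z - s x)(y - x) gweight s z x ∂μ(x)`, where `z = s y + n`. -/
lemma hasDerivAt_normalizer_path (hμ : MemLp id 2 μ) (y n s : ℝ) :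
    HasDerivAt (fun s => normalizer μ s (s * y + n))
      (-∫ x, ((s * y + n - s * x) * (y - x)) * gweight s (s * y + n) x ∂μ) s := by
  have hi : Integrable (fun x : ℝ => |y - x|) μ :=
    ((integrable_const y).sub (integrable_id_of_memLp hμ)).abs
  have h := (hasDerivAt_integral_of_dominated_loc_of_deriv_le (μ := μ) (s := Set.univ)
    (F := fun s x => gweight s (s * y + n) x)
    (F' := fun s x => -(((s * y + n - s * x) * (y - x)) * gweight s (s * y + n) x))
    (bound := fun x => |y - x|) (x₀ := s) univ_mem
    (Eventually.of_forall fun s => (integrable_gweight s _).aestronglyMeasurable)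
    (integrable_gweight s _) (Continuous.aestronglyMeasurable (by fun_prop))
    (ae_of_all _ fun x s _ => ?_) hi (ae_of_all _ fun x s _ => ?_)).2
  · rwa [integral_neg] at h
  · have := abs_mul_exp_neg_sq_le_one (s * y + n - s * x)
    rw [norm_neg, norm_mul, norm_mul, Real.norm_of_nonneg (gweight_pos _ _ _).le,
      Real.norm_eq_abs, Real.norm_eq_abs]
    calc |s * y + n - s * x| * |y - x| * gweight s (s * y + n) x
        = |s * y + n - s * x| * gweight s (s * y + n) x * |y - x| := by ring
      _ ≤ 1 * |y - x| := mul_le_mul_of_nonneg_right this (abs_nonneg _)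
      _ = |y - x| := one_mul _
  · have h1 : HasDerivAt (fun s : ℝ => s * y + n - s * x) (y - x) s := by
      exact ((((hasDerivAt_id s).mul_const y).add_const n).sub
        ((hasDerivAt_id s).mul_const x)).congr_deriv (by ring)
    have h2 := ((h1.pow 2).neg.div_const 2).exp
    refine h2.congr_deriv ?_
    simp only [gweight, Pi.pow_apply, Pi.neg_apply]
    push_cast
    ring

/-- Expansion of the posterior average of `(z - s x)(y - x)`. -/
lemma postAvg_score (hμ : MemLp id 2 μ) (s z y : ℝ) :
    postAvg μ s (fun x => (z - s * x) * (y - x)) z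
      = z * y - z * postAvg μ s (fun x => x) z - s * (postAvg μ s (fun x => x) z * y)
        + s * postAvg μ s (fun x => x ^ 2) z := by
  have i1 := integrable_id_of_memLp hμ
  have i2 := integrable_sq_of_memLp hμ
  have e : (fun x => (z - s * x) * (y - x))
      = fun x => (z * y + (-(z + s * y)) * x) + s * x ^ 2 := by
    ext x; ring
  have i3 : Integrable (fun x : ℝ => z * y + (-(z + s * y)) * x) μ :=
    (integrable_const _).add (i1.const_mul _)
  rw [e, postAvg_add i3 (i2.const_mul _),
    postAvg_add (integrable_const _) (i1.const_mul _), postAvg_const, postAvg_const_mul,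
    postAvg_const_mul]
  ring

lemma abs_postAvg_score_le (hμ : MemLp id 2 μ) {s : ℝ} (hs : 0 < s) (y n : ℝ) :
    |postAvg μ s (fun x => (s * y + n - s * x) * (y - x)) (s * y + n)|
      ≤ 8 * s * y ^ 2 + 9 * n ^ 2 / s + 4 * s * secondMoment μ := by
  set z := s * y + n with hz
  have hi := integrable_sq_affine hμ z s
  have hi2 : Integrable (fun x => (2 / s) * (z - s * x) ^ 2 + n ^ 2 / s) μ :=
    (hi.const_mul _).add (integrable_const _)
  have i1 := integrable_id_of_memLp hμ
  have hi0 : Integrable (fun x => (z - s * x) * (y - x)) μ := by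
    have e : (fun x => (z - s * x) * (y - x))
        = fun x => (z * y + (-(z + s * y)) * x) + s * x ^ 2 := by
      ext x; ring
    rw [e]
    exact ((integrable_const _).add (i1.const_mul _)).add ((integrable_sq_of_memLp hμ).const_mul s)
  -- with `t = z - s x` one has `s (y - x) = t - n`, so `s |t (y - x)| ≤ 2 t² + n²`
  have hb (x : ℝ) : |(z - s * x) * (y - x)| ≤ (2 / s) * (z - s * x) ^ 2 + n ^ 2 / s := by
    have e1 : (z - s * x) * (y - x) = (z - s * x) * (z - s * x - n) / s := by
      rw [hz]; field_simp; ring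
    have e2 : (2 / s) * (z - s * x) ^ 2 + n ^ 2 / s = (2 * (z - s * x) ^ 2 + n ^ 2) / s := by
      field_simp
    rw [e1, e2, abs_div, abs_of_pos hs]
    refine div_le_div_of_nonneg_right (abs_le.2 ⟨?_, ?_⟩) hs.le
    · nlinarith [sq_nonneg (z - s * x - n), sq_nonneg (z - s * x)]
    · nlinarith [sq_nonneg (z - s * x + n), sq_nonneg (z - s * x)]
  have hu := postAvg_mono hi0 hi2 (fun x => (abs_le.1 (hb x)).2) s z
  have hl := postAvg_mono hi2.neg hi0 (fun x => (abs_le.1 (hb x)).1) s z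
  have e : postAvg μ s (fun x => (2 / s) * (z - s * x) ^ 2 + n ^ 2 / s) z
      = (2 / s) * postAvg μ s (fun x => (z - s * x) ^ 2) z + n ^ 2 / s := by
    rw [postAvg_add (hi.const_mul _) (integrable_const _), postAvg_const_mul, postAvg_const]
  have en : postAvg μ s (-fun x => (2 / s) * (z - s * x) ^ 2 + n ^ 2 / s) z
      = -postAvg μ s (fun x => (2 / s) * (z - s * x) ^ 2 + n ^ 2 / s) z := by
    have := postAvg_const_mul (μ := μ) (-1) (fun x => (2 / s) * (z - s * x) ^ 2 + n ^ 2 / s) s z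
    simpa [neg_one_mul, Pi.neg_def] using this
  rw [en] at hl
  rw [e] at hu hl
  have h1 := postAvg_sq_affine_le hμ s z
  have h2 := integral_sq_affine_le hμ z s
  have h3 : z ^ 2 ≤ 2 * s ^ 2 * y ^ 2 + 2 * n ^ 2 := by
    rw [hz]; nlinarith [sq_nonneg (s * y - n)]
  have h4 : (2 / s) * postAvg μ s (fun x => (z - s * x) ^ 2) z
      ≤ (2 / s) * (2 * (2 * s ^ 2 * y ^ 2 + 2 * n ^ 2) + 2 * s ^ 2 * secondMoment μ) :=
    mul_le_mul_of_nonneg_left (by linarith) (by positivity)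
  have h5 : (2 / s) * (2 * (2 * s ^ 2 * y ^ 2 + 2 * n ^ 2) + 2 * s ^ 2 * secondMoment μ)
      + n ^ 2 / s = 8 * s * y ^ 2 + 9 * n ^ 2 / s + 4 * s * secondMoment μ := by
    field_simp; ring
  refine abs_le.2 ⟨?_, ?_⟩ <;> linarith

/-- The minimum mean-square error as a difference of second moments. -/
lemma channelMMSE_eq_sub (hμ : MemLp id 2 μ) (s : ℝ) :
    channelMMSE μ s = secondMoment μ - ∫ p, postAvg μ s (fun y => y) (s * p.1 + p.2) * p.1
      ∂(μ.prod (gaussianReal 0 1)) := by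
  have he := memLp_postMean hμ s
  have hf := memLp_fst (μ := μ) hμ
  have h0 := integral_error_mul_eq_zero hμ s (measurable_postMean hμ s) he
  have i1 : Integrable (fun p : ℝ × ℝ => p.1 ^ 2) (μ.prod (gaussianReal 0 1)) := hf.integrable_sq
  have i2 : Integrable (fun p : ℝ × ℝ => postAvg μ s (fun y => y) (s * p.1 + p.2) * p.1)
    (μ.prod (gaussianReal 0 1)) := he.integrable_mul hf
  have i3 : Integrable (fun p : ℝ × ℝ => (p.1 - postAvg μ s (fun y => y) (s * p.1 + p.2))
      * postAvg μ s (fun y => y) (s * p.1 + p.2)) (μ.prod (gaussianReal 0 1)) :=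
    (hf.sub he).integrable_mul he
  have e : channelMMSE μ s = ∫ p : ℝ × ℝ, (p.1 ^ 2
      - postAvg μ s (fun y => y) (s * p.1 + p.2) * p.1
      - (p.1 - postAvg μ s (fun y => y) (s * p.1 + p.2))
        * postAvg μ s (fun y => y) (s * p.1 + p.2)) ∂(μ.prod (gaussianReal 0 1)) := by
    rw [channelMMSE]; congr 1; ext p; ring
  have i12 : Integrable (fun p : ℝ × ℝ => p.1 ^ 2
      - postAvg μ s (fun y => y) (s * p.1 + p.2) * p.1) (μ.prod (gaussianReal 0 1)) := i1.sub i2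
  rw [e, integral_sub i12 i3, integral_sub i1 i2, h0, integral_fst_sq, sub_zero]

/-- The I-MMSE relation of Guo, Shamai and Verdú, in terms of the amplitude `s = √γ`. The derivative
of `-log` of the output density along `s ↦ s Y + N` is the posterior average of `(Z - s X)(Y - X)`,
whose expectation is evaluated with the tower property alone: `E[Z E[Y | Z]] = E[Z Y]`. -/
lemma hasDerivAt_channelInfo (hμ : MemLp id 2 μ) {s₀ : ℝ} (hs₀ : 0 < s₀) :
    HasDerivAt (channelInfo μ) (s₀ * channelMMSE μ s₀) s₀ := by
  have hs : Set.Ioo (s₀ / 2) (2 * s₀) ∈ 𝓝 s₀ := Ioo_mem_nhds (by linarith) (by linarith)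
  have h := (hasDerivAt_integral_of_dominated_loc_of_deriv_le (μ := μ.prod (gaussianReal 0 1))
    (F := fun s p => Real.log (normalizer μ s (s * p.1 + p.2)))
    (F' := fun s p =>
      -postAvg μ s (fun x => (s * p.1 + p.2 - s * x) * (p.1 - x)) (s * p.1 + p.2))
    (bound := fun p => 16 * s₀ * p.1 ^ 2 + 18 / s₀ * p.2 ^ 2 + 8 * s₀ * secondMoment μ)
    hs (Eventually.of_forall fun s => (integrable_log_normalizer hμ s).aestronglyMeasurable)
    (integrable_log_normalizer hμ s₀) ?_ (ae_of_all _ fun p s hs => ?_) ?_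
    (ae_of_all _ fun p s _ => ?_)).2
  · have h' := h.const_sub (-(1 / 2))
    refine h'.congr_deriv ?_
    have hf := memLp_fst (μ := μ) hμ
    have hz := memLp_output (μ := μ) hμ s₀
    have he := memLp_postMean hμ s₀
    have t := tower_postAvg (μ := μ) s₀ (g := fun y => y) (h := fun z => z) measurable_id
      (integrable_id_of_memLp hμ) measurable_id (hf.integrable_mul hz)
    have q := postAvg_sq_integral hμ s₀
    have i1 : Integrable (fun p : ℝ × ℝ => (s₀ * p.1 + p.2) * p.1) (μ.prod (gaussianReal 0 1)) :=
      hz.integrable_mul hf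
    have i2 : Integrable (fun p : ℝ × ℝ => (s₀ * p.1 + p.2) *
        postAvg μ s₀ (fun y => y) (s₀ * p.1 + p.2)) (μ.prod (gaussianReal 0 1)) :=
      hz.integrable_mul he
    have i3 : Integrable (fun p : ℝ × ℝ => s₀ * (postAvg μ s₀ (fun y => y) (s₀ * p.1 + p.2) * p.1))
        (μ.prod (gaussianReal 0 1)) := (he.integrable_mul hf).const_mul s₀
    have e2 : ∫ p : ℝ × ℝ, (s₀ * p.1 + p.2) * postAvg μ s₀ (fun y => y) (s₀ * p.1 + p.2)
        ∂(μ.prod (gaussianReal 0 1)) = ∫ p : ℝ × ℝ, (s₀ * p.1 + p.2) * p.1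
        ∂(μ.prod (gaussianReal 0 1)) := by
      have t2 := t.2
      simp only [mul_comm] at t2 ⊢
      exact t2
    rw [integral_neg, neg_neg, channelMMSE_eq_sub hμ]
    simp only [postAvg_score hμ]
    have i12 : Integrable (fun p : ℝ × ℝ => (s₀ * p.1 + p.2) * p.1 - (s₀ * p.1 + p.2) *
        postAvg μ s₀ (fun y => y) (s₀ * p.1 + p.2)) (μ.prod (gaussianReal 0 1)) := i1.sub i2
    have i123 : Integrable (fun p : ℝ × ℝ => (s₀ * p.1 + p.2) * p.1 - (s₀ * p.1 + p.2) *
        postAvg μ s₀ (fun y => y) (s₀ * p.1 + p.2)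
        - s₀ * (postAvg μ s₀ (fun y => y) (s₀ * p.1 + p.2) * p.1)) (μ.prod (gaussianReal 0 1)) :=
      i12.sub i3
    rw [integral_add i123 (q.1.const_mul s₀), integral_sub i12 i3,
      integral_sub i1 i2, e2, integral_const_mul, integral_const_mul, q.2, integral_fst_sq]
    ring
  · have hc : Continuous fun p : ℝ × ℝ =>
        -postAvg μ s₀ (fun x => (s₀ * p.1 + p.2 - s₀ * x) * (p.1 - x)) (s₀ * p.1 + p.2) := by
      simp only [postAvg_score hμ]
      have c1 : Continuous fun p : ℝ × ℝ => postAvg μ s₀ (fun x => x) (s₀ * p.1 + p.2) :=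
        (continuous_postMean hμ).comp (g := fun p : ℝ × ℝ => postAvg μ p.1 (fun y => y) p.2)
          (f := fun p : ℝ × ℝ => (s₀, s₀ * p.1 + p.2)) (by fun_prop)
      have c2 : Continuous fun p : ℝ × ℝ => postAvg μ s₀ (fun x => x ^ 2) (s₀ * p.1 + p.2) :=
        (continuous_postAvg (integrable_sq_of_memLp hμ)).comp
          (g := fun p : ℝ × ℝ => postAvg μ p.1 (fun y => y ^ 2) p.2)
          (f := fun p : ℝ × ℝ => (s₀, s₀ * p.1 + p.2)) (by fun_prop)
      fun_prop
    exact hc.aestronglyMeasurable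
  · have hs0 : 0 < s := by have := hs.1; linarith
    rw [norm_neg, Real.norm_eq_abs]
    refine (abs_postAvg_score_le hμ hs0 p.1 p.2).trans ?_
    have h1 : 9 * p.2 ^ 2 / s ≤ 18 / s₀ * p.2 ^ 2 := by
      have h2 : 18 / s₀ * p.2 ^ 2 = 9 * p.2 ^ 2 / (s₀ / 2) := by field_simp; ring
      rw [h2]
      exact div_le_div_of_nonneg_left (by positivity) (by positivity) hs.1.le
    have h2 := mul_le_mul_of_nonneg_right hs.2.le (sq_nonneg p.1)
    have h3 := mul_le_mul_of_nonneg_right hs.2.le (secondMoment_nonneg (μ := μ))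
    linarith
  · exact (((memLp_fst hμ).integrable_sq.const_mul _).add
      (memLp_snd.integrable_sq.const_mul _)).add (integrable_const _)
  · have hd := (hasDerivAt_normalizer_path hμ p.1 p.2 s).log (normalizer_pos _ _).ne'
    refine hd.congr_deriv ?_
    rw [postAvg, neg_div]

end

/-! ### Comparison of mean-square errors at different amplitudes -/

/-- Uncorrelated linear combinations of two independent centred Gaussians are independent. -/
lemma indepFun_linear_comb {Ω : Type*} [MeasurableSpace Ω] {P : Measure Ω} [IsProbabilityMeasure P]
    {U V : Ω → ℝ} {u v : ℝ≥0} (hU : HasLaw U (gaussianReal 0 u) P)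
    (hV : HasLaw V (gaussianReal 0 v) P) (h : IndepFun U V P) (α β α' β' : ℝ)
    (hcov : α * α' * u + β * β' * v = 0) :
    IndepFun (fun ω => α * U ω + β * V ω) (fun ω => α' * U ω + β' * V ω) P := by
  have hUV := h.hasGaussianLaw hU.hasGaussianLaw hV.hasGaussianLaw
  have hU2 := hU.hasGaussianLaw.memLp_two
  have hV2 := hV.hasGaussianLaw.memLp_two
  have vU : cov[U, U; P] = u := by rw [covariance_self hU.aemeasurable, hU.variance_eq]; simp
  have vV : cov[V, V; P] = v := by rw [covariance_self hV.aemeasurable, hV.variance_eq]; simp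
  have cUV : cov[U, V; P] = 0 := h.covariance_eq_zero hU2 hV2
  have cVU : cov[V, U; P] = 0 := h.symm.covariance_eq_zero hV2 hU2
  refine HasGaussianLaw.indepFun_of_covariance_eq_zero ?_ ?_
  · exact hUV.map_fun
      (((α • ContinuousLinearMap.fst ℝ ℝ ℝ) + β • ContinuousLinearMap.snd ℝ ℝ ℝ).prod
        ((α' • ContinuousLinearMap.fst ℝ ℝ ℝ) + β' • ContinuousLinearMap.snd ℝ ℝ ℝ))
  · have e1 : (fun ω => α * U ω + β * V ω) = (fun ω => α * U ω) + fun ω => β * V ω := rfl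
    have e2 : (fun ω => α' * U ω + β' * V ω) = (fun ω => α' * U ω) + fun ω => β' * V ω := rfl
    rw [e1, e2, covariance_add_left (hU2.const_mul α) (hV2.const_mul β)
        ((hU2.const_mul α').add (hV2.const_mul β')),
      covariance_add_right (hU2.const_mul α) (hU2.const_mul α') (hV2.const_mul β'),
      covariance_add_right (hV2.const_mul β) (hU2.const_mul α') (hV2.const_mul β')]
    simp only [covariance_const_mul_left, covariance_const_mul_right, vU, vV, cUV, cVU]
    linarith

/-- The law of a linear combination of two independent centred Gaussians. -/
lemma hasLaw_linear_comb {Ω : Type*} [MeasurableSpace Ω] {P : Measure Ω}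
    {U V : Ω → ℝ} {u v w : ℝ≥0} (hU : HasLaw U (gaussianReal 0 u) P)
    (hV : HasLaw V (gaussianReal 0 v) P) (h : IndepFun U V P) (α β : ℝ)
    (hw : (w : ℝ) = α ^ 2 * u + β ^ 2 * v) :
    HasLaw (fun ω => α * U ω + β * V ω) (gaussianReal 0 w) P := by
  have hU' := gaussianReal_const_mul hU α
  have hV' := gaussianReal_const_mul hV β
  have hi : IndepFun (fun ω => α * U ω) (fun ω => β * V ω) P :=
    h.comp (φ := fun x => α * x) (ψ := fun x => β * x) (by fun_prop) (by fun_prop)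
  refine ⟨hU'.aemeasurable.add hV'.aemeasurable, ?_⟩
  have := gaussianReal_add_gaussianReal_of_indepFun hi hU'.map_eq hV'.map_eq
  refine this.trans ?_
  congr 1
  · simp
  · apply NNReal.eq
    rw [hw]
    simp

/-- The planar standard Gaussian measure is invariant under reflections. -/
lemma measurePreserving_reflection {α β : ℝ} (h : α ^ 2 + β ^ 2 = 1) :
    MeasurePreserving (fun p : ℝ × ℝ => (α * p.1 + β * p.2, β * p.1 + -α * p.2))
      ((gaussianReal 0 1).prod (gaussianReal 0 1)) ((gaussianReal 0 1).prod (gaussianReal 0 1)) := by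
  set P := (gaussianReal 0 1).prod (gaussianReal 0 1)
  have h1 : HasLaw (fun p : ℝ × ℝ => p.1) (gaussianReal 0 1) P :=
    ⟨by fun_prop, measurePreserving_fst.map_eq⟩
  have h2 : HasLaw (fun p : ℝ × ℝ => p.2) (gaussianReal 0 1) P :=
    ⟨by fun_prop, measurePreserving_snd.map_eq⟩
  have h12 : IndepFun (fun p : ℝ × ℝ => p.1) (fun p : ℝ × ℝ => p.2) P :=
    indepFun_prod (X := fun x : ℝ => x) (Y := fun x : ℝ => x) measurable_id measurable_id
  have hi := indepFun_linear_comb h1 h2 h12 α β β (-α) (by simp; ring)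
  have l1 := hasLaw_linear_comb (w := 1) h1 h2 h12 α β (by simpa using h.symm)
  have l2 := hasLaw_linear_comb (w := 1) h1 h2 h12 β (-α) (by simp; linarith)
  refine ⟨by fun_prop, ?_⟩
  rw [(indepFun_iff_map_prod_eq_prod_map_map l1.aemeasurable l2.aemeasurable).1 hi, l1.map_eq,
    l2.map_eq]

section

variable {μ : Measure ℝ}

lemma channelMMSE_nonneg (s : ℝ) : 0 ≤ channelMMSE μ s := integral_nonneg fun _ => sq_nonneg _

variable [IsProbabilityMeasure μ]

/-- With a second, independent output `d Y + N'`, estimate `Y` by the posterior mean given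
`s₁ Y + N` corrected linearly by the second output. Since a reflection of the noises turns the two
outputs into `s Y + N`, `s² = s₁² + d²`, and an independent Gaussian, this bounds the error at
amplitude `s`. Equivalently, `1 / mmse - γ` is nondecreasing in `γ = s²`. -/
lemma channelMMSE_le_div (hμ : MemLp id 2 μ) {s s₁ d : ℝ} (hs : 0 < s)
    (hsd : s ^ 2 = s₁ ^ 2 + d ^ 2) :
    channelMMSE μ s ≤ channelMMSE μ s₁ / (1 + d ^ 2 * channelMMSE μ s₁) := by
  set G := gaussianReal 0 1 with hG
  set m := channelMMSE μ s₁ with hm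
  have hm0 : 0 ≤ m := channelMMSE_nonneg s₁
  set c := d * m / (1 + d ^ 2 * m) with hc
  have hden : 0 < 1 + d ^ 2 * m := by positivity
  set e := postAvg μ s₁ (fun y => y) with he
  have hem : Measurable e := measurable_postMean hμ s₁
  set f : ℝ → ℝ → ℝ := fun z₁ z₂ => e z₁ + c * (z₂ - d * e z₁) with hf
  -- `q = ((y, n), n')`
  set K : (ℝ × ℝ) × ℝ → ℝ := fun q => (q.1.1 - f (s₁ * q.1.1 + q.1.2) (d * q.1.1 + q.2)) ^ 2 with hK
  have K_eq (q : (ℝ × ℝ) × ℝ) : K q = (1 - c * d) ^ 2 * (q.1.1 - e (s₁ * q.1.1 + q.1.2)) ^ 2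
      + (-2 * (1 - c * d) * c) * ((q.1.1 - e (s₁ * q.1.1 + q.1.2)) * q.2) + c ^ 2 * q.2 ^ 2 := by
    simp only [hK, hf]; ring
  have hE : MemLp (fun p : ℝ × ℝ => p.1 - e (s₁ * p.1 + p.2)) 2 (μ.prod G) :=
    (memLp_fst hμ).sub (memLp_postMean hμ s₁)
  have hN : MemLp (fun n : ℝ => n) 2 G := memLp_id_gaussianReal (μ := 0) (v := 1) 2
  have j1 : Integrable (fun q : (ℝ × ℝ) × ℝ => (q.1.1 - e (s₁ * q.1.1 + q.1.2)) ^ 2)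
      ((μ.prod G).prod G) := hE.integrable_sq.comp_fst G
  have j2 : Integrable (fun q : (ℝ × ℝ) × ℝ => (q.1.1 - e (s₁ * q.1.1 + q.1.2)) * q.2)
      ((μ.prod G).prod G) := (hE.integrable one_le_two).mul_prod (hN.integrable one_le_two)
  have j3 : Integrable (fun q : (ℝ × ℝ) × ℝ => q.2 ^ 2) ((μ.prod G).prod G) :=
    hN.integrable_sq.comp_snd (μ.prod G)
  have v1 : ∫ q : (ℝ × ℝ) × ℝ, (q.1.1 - e (s₁ * q.1.1 + q.1.2)) ^ 2 ∂((μ.prod G).prod G) = m := by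
    rw [integral_fun_fst (fun p : ℝ × ℝ => (p.1 - e (s₁ * p.1 + p.2)) ^ 2)]
    simp [hm, channelMMSE, he, hG]
  have v2 : ∫ q : (ℝ × ℝ) × ℝ, (q.1.1 - e (s₁ * q.1.1 + q.1.2)) * q.2 ∂((μ.prod G).prod G) = 0 := by
    rw [integral_prod_mul (fun p : ℝ × ℝ => p.1 - e (s₁ * p.1 + p.2)) (fun n : ℝ => n)]
    simp [hG]
  have v3 : ∫ q : (ℝ × ℝ) × ℝ, q.2 ^ 2 ∂((μ.prod G).prod G) = 1 := by
    rw [integral_fun_snd (fun n : ℝ => n ^ 2)]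
    have := integral_snd_sq (μ := μ)
    rw [integral_fun_snd (fun n : ℝ => n ^ 2)] at this
    simpa using this
  have j12 : Integrable (fun q : (ℝ × ℝ) × ℝ =>
      (1 - c * d) ^ 2 * (q.1.1 - e (s₁ * q.1.1 + q.1.2)) ^ 2
      + (-2 * (1 - c * d) * c) * ((q.1.1 - e (s₁ * q.1.1 + q.1.2)) * q.2)) ((μ.prod G).prod G) :=
    (j1.const_mul _).add (j2.const_mul _)
  have hKi : Integrable K ((μ.prod G).prod G) := by
    simp only [funext K_eq]
    exact j12.add (j3.const_mul _)
  have hKv : ∫ q, K q ∂((μ.prod G).prod G) = m / (1 + d ^ 2 * m) := by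
    simp only [K_eq]
    rw [integral_add j12 (j3.const_mul _), integral_add (j1.const_mul _) (j2.const_mul _),
      integral_const_mul, integral_const_mul, integral_const_mul, v1, v2, v3, hc]
    field_simp
    ring
  -- after reflecting the pair of noises, both outputs are functions of `s y + n` and `n'`
  set α := s₁ / s with hα
  set β := d / s with hβ
  have hαβ : α ^ 2 + β ^ 2 = 1 := by
    rw [hα, hβ, div_pow, div_pow, ← add_div, ← hsd, div_self (by positivity)]
  set Φ : (ℝ × ℝ) × ℝ → (ℝ × ℝ) × ℝ := fun q =>
    ((q.1.1, α * q.1.2 + β * q.2), β * q.1.2 + -α * q.2) with hΦ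
  have hΦm : MeasurePreserving Φ ((μ.prod G).prod G) ((μ.prod G).prod G) :=
    ((measurePreserving_prodAssoc μ G G).symm _).comp
      (((MeasurePreserving.id μ).prod (measurePreserving_reflection hαβ)).comp
        (measurePreserving_prodAssoc μ G G))
  have hKΦi : Integrable (fun q => K (Φ q)) ((μ.prod G).prod G) :=
    hΦm.integrable_comp_of_integrable hKi
  have hKΦ : ∫ q, K (Φ q) ∂((μ.prod G).prod G) = m / (1 + d ^ 2 * m) := by
    rw [← hKv]
    conv_rhs => rw [← hΦm.map_eq]
    rw [integral_map hΦm.measurable.aemeasurable]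
    rw [hΦm.map_eq]
    exact hKi.aestronglyMeasurable
  have hKΦ_eq (p : ℝ × ℝ) (n' : ℝ) : K (Φ (p, n')) =
      (p.1 - (fun z => f (α * z + β * n') (β * z + -α * n')) (s * p.1 + p.2)) ^ 2 := by
    have h1 : α * (s * p.1 + p.2) + β * n' = s₁ * p.1 + (α * p.2 + β * n') := by
      rw [hα]; field_simp; ring
    have h2 : β * (s * p.1 + p.2) + -α * n' = d * p.1 + (β * p.2 + -α * n') := by
      rw [hβ]; field_simp; ring
    simp only [hK, hΦ, h1, h2]
  rw [← hKΦ, integral_prod_symm _ hKΦi]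
  have hslice := (integrable_prod_iff' hKΦi.aestronglyMeasurable).1 hKΦi
  have hle : ∀ᵐ n' ∂G, channelMMSE μ s ≤ ∫ p, K (Φ (p, n')) ∂(μ.prod G) := by
    filter_upwards [hslice.1] with n' hn'
    have hfm : Measurable fun z => f (α * z + β * n') (β * z + -α * n') := by
      simp only [hf]; fun_prop
    simp only [hKΦ_eq] at hn' ⊢
    refine channelMMSE_le hμ s hfm ?_
    have hdiff : MemLp (fun p : ℝ × ℝ => p.1 -
        (fun z => f (α * z + β * n') (β * z + -α * n')) (s * p.1 + p.2)) 2 (μ.prod G) := by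
      refine (memLp_two_iff_integrable_sq ?_).2 hn'
      exact (measurable_fst.sub (hfm.comp (by fun_prop))).aestronglyMeasurable
    have h := (memLp_fst hμ).sub hdiff
    refine h.ae_eq (ae_of_all _ fun p => ?_)
    simp only [Pi.sub_apply]
    ring
  calc channelMMSE μ s = ∫ _, channelMMSE μ s ∂G := by simp
    _ ≤ _ := integral_mono_ae (integrable_const _) hKΦi.integral_prod_right hle

lemma channelMMSE_zero : channelMMSE μ 0 = Var[id; μ] := by
  have h (z : ℝ) : postAvg μ 0 (fun y => y) z = ∫ y, y ∂μ := by
    have hne : Real.exp (-z ^ 2 / 2) ≠ 0 := (Real.exp_pos _).ne'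
    simp only [postAvg, normalizer, gweight, zero_mul, sub_zero, integral_mul_const]
    simp [hne]
  rw [variance_eq_integral aemeasurable_id, channelMMSE]
  simp only [h]
  rw [integral_fun_fst (fun y : ℝ => (y - ∫ y, y ∂μ) ^ 2)]
  simp

lemma antitone_channelMMSE (hμ : MemLp id 2 μ) {s t : ℝ} (hs : 0 ≤ s) (hst : s ≤ t) :
    channelMMSE μ t ≤ channelMMSE μ s := by
  rcases hs.eq_or_lt with rfl | hs
  · rcases hst.eq_or_lt with rfl | ht
    · exact le_rfl
    have h := channelMMSE_le_div hμ (s₁ := 0) (d := t) ht (by ring)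
    exact h.trans (div_le_self (channelMMSE_nonneg _)
      (by linarith [mul_nonneg (sq_nonneg t) (channelMMSE_nonneg (μ := μ) 0)]))
  · have h0 : 0 ≤ t ^ 2 - s ^ 2 := by nlinarith
    have h := channelMMSE_le_div hμ (s₁ := s) (d := √(t ^ 2 - s ^ 2)) (hs.trans_le hst)
      (by rw [Real.sq_sqrt h0]; ring)
    refine h.trans (div_le_self (channelMMSE_nonneg _) ?_)
    have := mul_nonneg (sq_nonneg (√(t ^ 2 - s ^ 2))) (channelMMSE_nonneg (μ := μ) s)
    linarith

/-- Lower semicontinuity of the mean-square error at amplitude zero, from Fatou's lemma. -/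
lemma variance_le_of_channelMMSE_le (hμ : MemLp id 2 μ) {L : ℝ}
    (hL : ∀ s, 0 < s → channelMMSE μ s ≤ L) : Var[id; μ] ≤ L := by
  set s : ℕ → ℝ := fun k => 1 / ((k : ℝ) + 1) with hs
  have hs0 : Tendsto s atTop (𝓝 0) := tendsto_one_div_add_atTop_nhds_zero_nat
  have hspos (k : ℕ) : 0 < s k := by positivity
  set D : ℝ → ℝ × ℝ → ℝ := fun s p => (p.1 - postAvg μ s (fun y => y) (s * p.1 + p.2)) ^ 2 with hD
  have hDm (t : ℝ) : Measurable (D t) :=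
    (measurable_fst.sub ((measurable_postMean hμ t).comp (by fun_prop))).pow_const 2
  have hDi (t : ℝ) : ∫⁻ p, ENNReal.ofReal (D t p) ∂(μ.prod (gaussianReal 0 1))
      = ENNReal.ofReal (channelMMSE μ t) :=
    (ofReal_integral_eq_lintegral_ofReal ((memLp_fst hμ).sub (memLp_postMean hμ t)).integrable_sq
      (ae_of_all _ fun p => sq_nonneg _)).symm
  have hlim (p : ℝ × ℝ) : Tendsto (fun k => ENNReal.ofReal (D (s k) p)) atTop
      (𝓝 (ENNReal.ofReal (D 0 p))) := by
    have hc : Continuous fun t : ℝ => D t p := by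
      have c1 : Continuous fun t : ℝ => postAvg μ t (fun x => x) (t * p.1 + p.2) :=
        (continuous_postMean hμ).comp (g := fun p : ℝ × ℝ => postAvg μ p.1 (fun y => y) p.2)
          (f := fun t : ℝ => (t, t * p.1 + p.2)) (by fun_prop)
      exact (continuous_const.sub c1).pow 2
    exact ENNReal.tendsto_ofReal ((hc.tendsto 0).comp hs0)
  have hfatou := lintegral_liminf_le (μ := μ.prod (gaussianReal 0 1)) (u := atTop)
    (f := fun k p => ENNReal.ofReal (D (s k) p)) fun k => (hDm (s k)).ennreal_ofReal
  simp only [fun p => (hlim p).liminf_eq, hDi] at hfatou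
  have hL0 : 0 ≤ L := (channelMMSE_nonneg 1).trans (hL 1 one_pos)
  have h2 : ENNReal.ofReal (channelMMSE μ 0) ≤ ENNReal.ofReal L := by
    refine hfatou.trans ?_
    refine (liminf_le_liminf (v := fun _ => ENNReal.ofReal L)
      (Eventually.of_forall fun k => ENNReal.ofReal_le_ofReal (hL _ (hspos k)))).trans ?_
    simp
  rw [← channelMMSE_zero]
  exact (ENNReal.ofReal_le_ofReal_iff hL0).1 h2

end

/-! ### Mutual information as a Kullback–Leibler divergence -/

section

variable {Ω : Type*} [MeasurableSpace Ω] {P : Measure Ω} {U W : Ω → ℝ} {v : ℝ≥0}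

lemma memLp_id_map (hU : Measurable U) (hU2 : MemLp U 2 P) : MemLp id 2 (P.map U) :=
  (memLp_map_measure_iff (by fun_prop) hU.aemeasurable).2 hU2

variable [IsProbabilityMeasure P]

lemma map_input_output (hU : Measurable U) (hW : Measurable W)
    (hWlaw : P.map W = gaussianReal 0 v) (hUW : IndepFun U W P) (hv : v ≠ 0) (b : ℝ) :
    P.map (fun ω => (U ω, b * U ω + W ω))
      = ((P.map U).prod volume).withDensity fun p => gaussianPDF 0 v (p.2 - b * p.1) := by
  have := Measure.isProbabilityMeasure_map (μ := P) hU.aemeasurable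
  rw [← map_prod_gaussianReal_channel (P.map U) b hv, ← hWlaw,
    ← (indepFun_iff_map_prod_eq_prod_map_map hU.aemeasurable hW.aemeasurable).1 hUW,
    Measure.map_map (by fun_prop) (by fun_prop)]
  rfl

/-- The density of the output of a Gaussian channel. -/
lemma map_output (hU : Measurable U) (hW : Measurable W)
    (hWlaw : P.map W = gaussianReal 0 v) (hUW : IndepFun U W P) (hv : v ≠ 0) (b : ℝ) :
    P.map (fun ω => b * U ω + W ω) = volume.withDensity fun z =>
      ENNReal.ofReal ((√(2 * Real.pi * v))⁻¹ * normalizer (P.map U) (b / √v) (z / √v)) := by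
  have := Measure.isProbabilityMeasure_map (μ := P) hU.aemeasurable
  have hfm : Measurable fun p : ℝ × ℝ => gaussianPDF 0 v (p.2 - b * p.1) :=
    (measurable_gaussianPDF 0 v).comp (by fun_prop)
  have e : P.map (fun ω => b * U ω + W ω)
      = (P.map (fun ω => (U ω, b * U ω + W ω))).map Prod.snd := by
    rw [Measure.map_map measurable_snd (by fun_prop)]
    rfl
  rw [e, map_input_output hU hW hWlaw hUW hv]
  refine Measure.ext_of_lintegral _ fun f hf => ?_
  rw [lintegral_map hf measurable_snd, lintegral_withDensity_eq_lintegral_mul _ hfm (by fun_prop),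
    lintegral_withDensity_eq_lintegral_mul _
      (Measurable.ennreal_ofReal (Continuous.measurable (by fun_prop))) hf,
    lintegral_prod_symm _ (hfm.mul (by fun_prop)).aemeasurable]
  refine lintegral_congr fun z => ?_
  simp only [Pi.mul_apply]
  have hz : Measurable fun y : ℝ => gaussianPDF 0 v (z - b * y) :=
    (measurable_gaussianPDF 0 v).comp (by fun_prop)
  rw [lintegral_mul_const _ hz]
  congr 1
  rw [normalizer, ← integral_const_mul, ofReal_integral_eq_lintegral_ofReal
    ((integrable_gweight _ _).const_mul _)
    (ae_of_all _ fun y => mul_nonneg (by positivity) (gweight_pos _ _ _).le)]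
  refine lintegral_congr fun y => ?_
  rw [gaussianPDF, gaussianPDFReal_sub_mul hv]

/-- The density of the joint law of input and output relative to the product of the marginals. -/
lemma map_input_output_eq_withDensity (hU : Measurable U) (hW : Measurable W)
    (hWlaw : P.map W = gaussianReal 0 v) (hUW : IndepFun U W P) (hv : v ≠ 0) (b : ℝ) :
    P.map (fun ω => (U ω, b * U ω + W ω))
      = ((P.map U).prod (P.map fun ω => b * U ω + W ω)).withDensity fun p =>
        ENNReal.ofReal (gweight (b / √v) (p.2 / √v) p.1
          / normalizer (P.map U) (b / √v) (p.2 / √v)) := by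
  have := Measure.isProbabilityMeasure_map (μ := P) hU.aemeasurable
  have hq : Measurable fun z : ℝ =>
      ENNReal.ofReal ((√(2 * Real.pi * v))⁻¹ * normalizer (P.map U) (b / √v) (z / √v)) :=
    Measurable.ennreal_ofReal (Continuous.measurable (by fun_prop))
  have hr : Measurable fun p : ℝ × ℝ => ENNReal.ofReal (gweight (b / √v) (p.2 / √v) p.1
      / normalizer (P.map U) (b / √v) (p.2 / √v)) :=
    Measurable.ennreal_ofReal ((Continuous.measurable (by fun_prop)).div
      (Continuous.measurable (by fun_prop)))
  rw [map_input_output hU hW hWlaw hUW hv, map_output hU hW hWlaw hUW hv,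
    prod_withDensity_right hq, ← withDensity_mul (f := fun p : ℝ × ℝ => ENNReal.ofReal
      ((√(2 * Real.pi * v))⁻¹ * normalizer (P.map U) (b / √v) (p.2 / √v))) _
      (hq.comp measurable_snd) hr]
  congr 1
  ext p
  simp only [Pi.mul_apply]
  have hn := normalizer_pos (μ := P.map U) (b / √v) (p.2 / √v)
  rw [← ENNReal.ofReal_mul (mul_nonneg (by positivity) hn.le), gaussianPDF,
    gaussianPDFReal_sub_mul hv]
  congr 1
  field_simp

lemma map_prod_normalized_noise (hU : Measurable U) (hW : Measurable W)
    (hWlaw : P.map W = gaussianReal 0 v) (hUW : IndepFun U W P) (hv : v ≠ 0) :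
    P.map (fun ω => (U ω, W ω / √v)) = (P.map U).prod (gaussianReal 0 1) := by
  have hlaw := gaussianReal_div_const (⟨hW.aemeasurable, hWlaw⟩ : HasLaw W (gaussianReal 0 v) P) √v
  have hi : IndepFun U (fun ω => W ω / √v) P :=
    hUW.comp (φ := fun x => x) (ψ := fun x => x / √v) measurable_id (by fun_prop)
  rw [(indepFun_iff_map_prod_eq_prod_map_map hU.aemeasurable hlaw.aemeasurable).1 hi, hlaw.map_eq]
  congr 2
  · simp
  · apply NNReal.eq
    have : (v : ℝ) ≠ 0 := by exact_mod_cast hv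
    simp [this]

/-- The mutual information across a Gaussian channel depends only on the input law and the
signal-to-noise ratio `b² / v`, and it is finite for square-integrable inputs. -/
theorem mutualInfo_gaussian_channel (hU : Measurable U) (hU2 : MemLp U 2 P) (hW : Measurable W)
    (hWlaw : P.map W = gaussianReal 0 v) (hUW : IndepFun U W P) (hv : v ≠ 0) (b : ℝ) :
    mutualInfo U (fun ω => b * U ω + W ω) P = ENNReal.ofReal (channelInfo (P.map U) (b / √v)) ∧
      0 ≤ channelInfo (P.map U) (b / √v) := by
  have := Measure.isProbabilityMeasure_map (μ := P) hU.aemeasurable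
  have hV : Measurable fun ω => b * U ω + W ω := by fun_prop
  have := Measure.isProbabilityMeasure_map (μ := P) hV.aemeasurable
  have hUV : Measurable fun ω => (U ω, b * U ω + W ω) := by fun_prop
  have := Measure.isProbabilityMeasure_map (μ := P) hUV.aemeasurable
  have hv0 : (0 : ℝ) < v := by exact_mod_cast pos_iff_ne_zero.2 hv
  have hμ := memLp_id_map hU hU2
  set ν := P.map U with hν
  set ρ := ν.prod (P.map fun ω => b * U ω + W ω) with hρ
  set J := P.map (fun ω => (U ω, b * U ω + W ω)) with hJ
  set r : ℝ × ℝ → ℝ := fun p => gweight (b / √v) (p.2 / √v) p.1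
    / normalizer ν (b / √v) (p.2 / √v) with hr
  have hrm : Measurable r :=
    (Continuous.measurable (by fun_prop)).div (Continuous.measurable (by fun_prop))
  have hJρ : J = ρ.withDensity fun p => ENNReal.ofReal (r p) :=
    map_input_output_eq_withDensity hU hW hWlaw hUW hv b
  have hac : J ≪ ρ := by rw [hJρ]; exact withDensity_absolutelyContinuous _ _
  have hllr : llr J ρ =ᵐ[J] fun p => -(p.2 / √v - b / √v * p.1) ^ 2 / 2
      - Real.log (normalizer ν (b / √v) (p.2 / √v)) := by
    refine hac.ae_le ?_
    filter_upwards [(congrArg (fun J' => J'.rnDeriv ρ) hJρ ▸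
      Measure.rnDeriv_withDensity ρ hrm.ennreal_ofReal :
        J.rnDeriv ρ =ᵐ[ρ] fun p => ENNReal.ofReal (r p))] with p hp
    have hn := normalizer_pos (μ := ν) (b / √v) (p.2 / √v)
    have hg := gweight_pos (b / √v) (p.2 / √v) p.1
    rw [llr, hp, ENNReal.toReal_ofReal (div_pos hg hn).le,
      Real.log_div hg.ne' hn.ne', gweight, Real.log_exp]
  -- transport to the normalized channel
  have hnorm := map_prod_normalized_noise hU hW hWlaw hUW hv
  have hT : Measurable fun ω => (U ω, W ω / √v) := by fun_prop
  have hs0 : √(v : ℝ) ≠ 0 := (Real.sqrt_pos.2 hv0).ne'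
  set H : ℝ × ℝ → ℝ := fun p => -p.2 ^ 2 / 2
    - Real.log (normalizer ν (b / √v) (b / √v * p.1 + p.2)) with hH
  have hHi : Integrable H (ν.prod (gaussianReal 0 1)) :=
    (memLp_snd.integrable_sq.neg.div_const 2).sub (integrable_log_normalizer hμ _)
  have hHv : ∫ p, H p ∂(ν.prod (gaussianReal 0 1)) = channelInfo ν (b / √v) := by
    have i1 : Integrable (fun p : ℝ × ℝ => -p.2 ^ 2 / 2) (ν.prod (gaussianReal 0 1)) :=
      memLp_snd.integrable_sq.neg.div_const 2
    rw [integral_sub i1 (integrable_log_normalizer hμ _), integral_div, integral_neg,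
      integral_snd_sq, channelInfo]
    norm_num
  have hpt (ω : Ω) : -((b * U ω + W ω) / √v - b / √v * U ω) ^ 2 / 2
      - Real.log (normalizer ν (b / √v) ((b * U ω + W ω) / √v)) = H (U ω, W ω / √v) := by
    have e1 : (b * U ω + W ω) / √v - b / √v * U ω = W ω / √v := by ring
    have e2 : (b * U ω + W ω) / √v = b / √v * U ω + W ω / √v := by ring
    simp only [hH]
    rw [e1, e2]
  rw [← hnorm] at hHi hHv
  have hLm : Measurable fun p : ℝ × ℝ => -(p.2 / √v - b / √v * p.1) ^ 2 / 2
      - Real.log (normalizer ν (b / √v) (p.2 / √v)) :=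
    (Continuous.measurable (by fun_prop)).sub
      (Measurable.log (Continuous.measurable (by fun_prop)))
  have hint : Integrable (llr J ρ) J := by
    rw [integrable_congr hllr, integrable_map_measure hLm.aestronglyMeasurable hUV.aemeasurable]
    refine ((integrable_map_measure hHi.aestronglyMeasurable hT.aemeasurable).1 hHi).congr
      (ae_of_all _ fun ω => (hpt ω).symm)
  have hval : ∫ p, llr J ρ p ∂J = channelInfo ν (b / √v) := by
    rw [integral_congr_ae hllr, integral_map hUV.aemeasurable hLm.aestronglyMeasurable, ← hHv,
      integral_map hT.aemeasurable hHi.aestronglyMeasurable]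
    exact integral_congr_ae (ae_of_all _ hpt)
  have hkl : InformationTheory.klDiv J ρ = ENNReal.ofReal (channelInfo ν (b / √v)) := by
    rw [InformationTheory.klDiv_of_ac_of_integrable hac hint, hval]
    simp
  refine ⟨hkl, ?_⟩
  have h0 := InformationTheory.toReal_klDiv_of_measure_eq hac (by simp)
  rw [← hval, ← h0]
  exact ENNReal.toReal_nonneg

/-- The differential entropy `-∫ p log p` of a law with density `p`. -/
noncomputable def diffEntropy (ρ : Measure ℝ) : ℝ := -∫ z, Real.log (ρ.rnDeriv volume z).toReal ∂ρ

/-- The mutual information as entropy of the output minus entropy `½ log (2πe v)` of the noise. -/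
lemma channelInfo_eq_diffEntropy (hU : Measurable U) (hU2 : MemLp U 2 P) (hW : Measurable W)
    (hWlaw : P.map W = gaussianReal 0 v) (hUW : IndepFun U W P) (hv : v ≠ 0) (b : ℝ) :
    channelInfo (P.map U) (b / √v)
      = diffEntropy (P.map fun ω => b * U ω + W ω) - (1 + Real.log (2 * Real.pi * v)) / 2 := by
  have := Measure.isProbabilityMeasure_map (μ := P) hU.aemeasurable
  have hV : Measurable fun ω => b * U ω + W ω := by fun_prop
  have := Measure.isProbabilityMeasure_map (μ := P) hV.aemeasurable
  have hv0 : (0 : ℝ) < v := by exact_mod_cast pos_iff_ne_zero.2 hv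
  have hμ := memLp_id_map hU hU2
  have hnorm := map_prod_normalized_noise hU hW hWlaw hUW hv
  have hT : Measurable fun ω => (U ω, W ω / √v) := by fun_prop
  set ν := P.map U with hν
  set ρ := P.map (fun ω => b * U ω + W ω) with hρ
  set q : ℝ → ℝ := fun z => (√(2 * Real.pi * v))⁻¹ * normalizer ν (b / √v) (z / √v) with hq
  have hqm : Measurable q := Continuous.measurable (by fun_prop)
  have hρq : ρ = volume.withDensity fun z => ENNReal.ofReal (q z) :=
    map_output hU hW hWlaw hUW hv b
  have hac : ρ ≪ volume := by rw [hρq]; exact withDensity_absolutelyContinuous _ _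
  have hlog : (fun z => Real.log (ρ.rnDeriv volume z).toReal) =ᵐ[ρ] fun z =>
      -(Real.log (2 * Real.pi * v) / 2) + Real.log (normalizer ν (b / √v) (z / √v)) := by
    refine hac.ae_le ?_
    filter_upwards [(congrArg (fun ρ' => ρ'.rnDeriv volume) hρq ▸
      Measure.rnDeriv_withDensity volume hqm.ennreal_ofReal :
        ρ.rnDeriv volume =ᵐ[volume] fun z => ENNReal.ofReal (q z))] with z hz
    have hn := normalizer_pos (μ := ν) (b / √v) (z / √v)
    have hc : 0 < √(2 * Real.pi * v) := Real.sqrt_pos.2 (by positivity)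
    rw [hz, ENNReal.toReal_ofReal (mul_nonneg (inv_pos.2 hc).le hn.le),
      Real.log_mul (inv_pos.2 hc).ne' hn.ne', Real.log_inv, Real.log_sqrt (by positivity)]
  have hLm : Measurable fun z => Real.log (normalizer ν (b / √v) (z / √v)) :=
    Measurable.log (Continuous.measurable (by fun_prop))
  have hLi := integrable_log_normalizer hμ (b / √v)
  have e2 (ω : Ω) : (b * U ω + W ω) / √v = b / √v * U ω + W ω / √v := by ring
  have hI : Integrable (fun z => Real.log (normalizer ν (b / √v) (z / √v))) ρ := by
    rw [integrable_map_measure hLm.aestronglyMeasurable hV.aemeasurable]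
    rw [← hnorm] at hLi
    refine ((integrable_map_measure hLi.aestronglyMeasurable hT.aemeasurable).1 hLi).congr
      (ae_of_all _ fun ω => ?_)
    simp only [Function.comp_apply, e2]
  have hval : ∫ z, Real.log (normalizer ν (b / √v) (z / √v)) ∂ρ
      = ∫ p, Real.log (normalizer ν (b / √v) (b / √v * p.1 + p.2)) ∂(ν.prod (gaussianReal 0 1)) := by
    rw [← hnorm] at hLi ⊢
    rw [integral_map hV.aemeasurable hLm.aestronglyMeasurable,
      integral_map hT.aemeasurable hLi.aestronglyMeasurable]
    simp only [e2]
  rw [diffEntropy, integral_congr_ae hlog, integral_add (integrable_const _) hI, hval, channelInfo]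
  simp
  ring

end

/-! ### Estimation errors and maximal correlation -/

section

variable {Ω : Type*} [MeasurableSpace Ω] {P : Measure Ω}

lemma mmse_congr {β : Type*} [MeasurableSpace β] {U : Ω → ℝ} {V : Ω → β} {f : Ω → ℝ}
    (h : P[U | MeasurableSpace.comap V inferInstance] =ᵐ[P] f) :
    mmse U V P = ∫ ω, (U ω - f ω) ^ 2 ∂P := by
  refine integral_congr_ae ?_
  filter_upwards [h] with ω h
  rw [h]

variable [IsProbabilityMeasure P]

lemma IndepFun.prodMk_right_of_prodMk_left {α β γ : Type*} [MeasurableSpace α]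
    [MeasurableSpace β] [MeasurableSpace γ] {A : Ω → α} {B : Ω → β} {C : Ω → γ}
    (hA : Measurable A) (hB : Measurable B) (hC : Measurable C)
    (hAB_C : IndepFun (fun ω => (A ω, B ω)) C P) (hAB : IndepFun A B P) :
    IndepFun A (fun ω => (B ω, C ω)) P := by
  have := Measure.isProbabilityMeasure_map (μ := P) hA.aemeasurable
  have := Measure.isProbabilityMeasure_map (μ := P) hB.aemeasurable
  have := Measure.isProbabilityMeasure_map (μ := P) hC.aemeasurable
  have hBC : IndepFun B C P := hAB_C.comp (φ := Prod.snd) (ψ := id) measurable_snd measurable_id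
  rw [indepFun_iff_map_prod_eq_prod_map_map hA.aemeasurable (hB.prodMk hC).aemeasurable,
    (indepFun_iff_map_prod_eq_prod_map_map hB.aemeasurable hC.aemeasurable).1 hBC,
    ← (measurePreserving_prodAssoc (P.map A) (P.map B) (P.map C)).map_eq,
    ← (indepFun_iff_map_prod_eq_prod_map_map hA.aemeasurable hB.aemeasurable).1 hAB,
    ← (indepFun_iff_map_prod_eq_prod_map_map (hA.prodMk hB).aemeasurable hC.aemeasurable).1 hAB_C,
    Measure.map_map (MeasurableEquiv.measurable _) (by fun_prop)]
  rfl

/-- If `R` is independent of `V` and `T` is a function of `V`, then `E[T + R | V] = T + E[R]`. -/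
lemma condExp_add_of_indepFun {β : Type*} [MeasurableSpace β] {V : Ω → β} (hV : Measurable V)
    {R : Ω → ℝ} (hR : Measurable R) (hRi : Integrable R P) (hRV : IndepFun R V P)
    {t : β → ℝ} (ht : Measurable t) (hti : Integrable (fun ω => t (V ω)) P) :
    P[fun ω => t (V ω) + R ω | MeasurableSpace.comap V inferInstance]
      =ᵐ[P] fun ω => t (V ω) + ∫ ω, R ω ∂P := by
  have hm : MeasurableSpace.comap V inferInstance ≤ (inferInstance : MeasurableSpace Ω) :=
    hV.comap_le
  have h1 := condExp_add hti hRi (MeasurableSpace.comap V inferInstance)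
  have h2 : P[fun ω => t (V ω) | MeasurableSpace.comap V inferInstance] = fun ω => t (V ω) :=
    condExp_of_stronglyMeasurable hm
      (ht.comp (comap_measurable V)).stronglyMeasurable hti
  have h3 := condExp_indep_eq (μ := P) hR.comap_le hm
    (comap_measurable R).stronglyMeasurable hRV
  refine h1.trans ?_
  filter_upwards [h3] with ω h3
  simp only [Pi.add_apply, h2, h3]

lemma map_input_noise {U N : Ω → ℝ} (hU : Measurable U) (hN : Measurable N)
    (hNlaw : P.map N = gaussianReal 0 1) (hUN : IndepFun U N P) :
    P.map (fun ω => (U ω, N ω)) = (P.map U).prod (gaussianReal 0 1) := by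
  rw [(indepFun_iff_map_prod_eq_prod_map_map hU.aemeasurable hN.aemeasurable).1 hUN, hNlaw]

lemma integral_input_noise {U N : Ω → ℝ} (hU : Measurable U) (hN : Measurable N)
    (hNlaw : P.map N = gaussianReal 0 1) (hUN : IndepFun U N P) {K : ℝ × ℝ → ℝ}
    (hK : Measurable K) :
    ∫ ω, K (U ω, N ω) ∂P = ∫ p, K p ∂((P.map U).prod (gaussianReal 0 1)) := by
  rw [← map_input_noise hU hN hNlaw hUN,
    integral_map (hU.prodMk hN).aemeasurable hK.aestronglyMeasurable]

/-- The posterior mean is the conditional expectation of the input given the output. -/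
lemma condExp_channel {U N : Ω → ℝ} (hU : Measurable U) (hU2 : MemLp U 2 P) (hN : Measurable N)
    (hNlaw : P.map N = gaussianReal 0 1) (hUN : IndepFun U N P) (s : ℝ) :
    P[U | MeasurableSpace.comap (fun ω => s * U ω + N ω) inferInstance]
      =ᵐ[P] fun ω => postAvg (P.map U) s (fun y => y) (s * U ω + N ω) := by
  have := Measure.isProbabilityMeasure_map (μ := P) hU.aemeasurable
  have hμ := memLp_id_map hU hU2
  have hV : Measurable fun ω => s * U ω + N ω := by fun_prop
  have hem := measurable_postMean hμ s
  have hmap := map_input_noise hU hN hNlaw hUN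
  have heI : Integrable (fun ω => postAvg (P.map U) s (fun y => y) (s * U ω + N ω)) P := by
    have h := (memLp_postMean hμ s).integrable one_le_two
    rw [← hmap] at h
    exact (integrable_map_measure h.aestronglyMeasurable (hU.prodMk hN).aemeasurable).1 h
  refine (ae_eq_condExp_of_forall_setIntegral_eq hV.comap_le (hU2.integrable one_le_two)
    (fun _ _ _ => heI.integrableOn) ?_ ?_).symm
  · rintro _ ⟨B, hB, rfl⟩ -
    have hind : Measurable (B.indicator fun _ => (1 : ℝ)) := measurable_const.indicator hB
    have hi : Integrable (fun p : ℝ × ℝ => p.1 * B.indicator (fun _ => (1 : ℝ)) (s * p.1 + p.2))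
        ((P.map U).prod (gaussianReal 0 1)) := by
      refine ((memLp_fst hμ).integrable one_le_two).mul_bdd (c := 1)
        (hind.comp (by fun_prop)).aestronglyMeasurable (ae_of_all _ fun p => ?_)
      simp only [Set.indicator]
      split_ifs <;> simp
    have ht := (tower_postAvg (μ := P.map U) s (g := fun y => y) measurable_id
      (integrable_id_of_memLp hμ) hind hi).2
    rw [← integral_indicator (hV hB), ← integral_indicator (hV hB)]
    have key (g : ℝ × ℝ → ℝ) (hg : Measurable g) :
        ∫ ω, ((fun ω => s * U ω + N ω) ⁻¹' B).indicator (fun ω => g (U ω, N ω)) ω ∂P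
          = ∫ p, g p * B.indicator (fun _ => (1 : ℝ)) (s * p.1 + p.2)
            ∂((P.map U).prod (gaussianReal 0 1)) := by
      rw [← integral_input_noise hU hN hNlaw hUN
        (K := fun p => g p * B.indicator (fun _ => (1 : ℝ)) (s * p.1 + p.2))
        (hg.mul (hind.comp (by fun_prop)))]
      refine integral_congr_ae (ae_of_all _ fun ω => ?_)
      by_cases h : s * U ω + N ω ∈ B <;> simp [h, Set.indicator]
    rw [key (fun p => postAvg (P.map U) s (fun y => y) (s * p.1 + p.2))
      (hem.comp (by fun_prop)), key (fun p => p.1) measurable_fst, ht]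
  · exact ((hem.comp (comap_measurable _)).stronglyMeasurable).aestronglyMeasurable

lemma mmse_channel {U N : Ω → ℝ} (hU : Measurable U) (hU2 : MemLp U 2 P) (hN : Measurable N)
    (hNlaw : P.map N = gaussianReal 0 1) (hUN : IndepFun U N P) (s : ℝ) :
    mmse U (fun ω => s * U ω + N ω) P = channelMMSE (P.map U) s := by
  have := Measure.isProbabilityMeasure_map (μ := P) hU.aemeasurable
  have hem := measurable_postMean (memLp_id_map hU hU2) s
  rw [mmse_congr (condExp_channel hU hU2 hN hNlaw hUN s), channelMMSE,
    ← integral_input_noise hU hN hNlaw hUN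
      (K := fun p => (p.1 - postAvg (P.map U) s (fun y => y) (s * p.1 + p.2)) ^ 2)
      ((measurable_fst.sub (hem.comp (by fun_prop))).pow_const 2)]

/-- In `Y = a X + M`, the error of estimating `Y` from `(s Y + N, X)` splits off: there is a
residual `R`, independent of `(s Y + N, X)` and centred, with `E[R²] = v / (1 + s² v)`, such that
`Y - R` is an affine function of `(s Y + N, X)`. -/
lemma exists_residual {X M N : Ω → ℝ} {v : ℝ≥0} (hX : Measurable X) (hM : Measurable M)
    (hN : Measurable N) (hMlaw : P.map M = gaussianReal 0 v) (hNlaw : P.map N = gaussianReal 0 1)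
    (hXM : IndepFun X M P) (hXMN : IndepFun (fun ω => (X ω, M ω)) N P) (a s : ℝ) :
    ∃ (R : Ω → ℝ) (c : ℝ), Measurable R ∧ MemLp R 2 P ∧ ∫ ω, R ω ∂P = 0 ∧
      ∫ ω, R ω ^ 2 ∂P = v / (1 + s ^ 2 * v) ∧
      IndepFun R (fun ω => (s * (a * X ω + M ω) + N ω, X ω)) P ∧
      ∀ ω, a * X ω + M ω = a * X ω + c * (s * (a * X ω + M ω) + N ω - s * a * X ω) + R ω := by
  have hv : (0 : ℝ) ≤ v := v.2
  have hMl : HasLaw M (gaussianReal 0 v) P := ⟨hM.aemeasurable, hMlaw⟩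
  have hNl : HasLaw N (gaussianReal 0 1) P := ⟨hN.aemeasurable, hNlaw⟩
  have hMN : IndepFun M N P := hXMN.comp (φ := Prod.snd) (ψ := id) measurable_snd measurable_id
  have hX_MN := IndepFun.prodMk_right_of_prodMk_left hX hM hN hXMN hXM
  have hden : 0 < 1 + s ^ 2 * (v : ℝ) := by positivity
  set c : ℝ := s * v / (1 + s ^ 2 * v) with hc
  set R : Ω → ℝ := fun ω => (1 - c * s) * M ω + -c * N ω with hR
  set T : Ω → ℝ := fun ω => s * M ω + 1 * N ω with hT
  have hRm : Measurable R := by fun_prop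
  have hTm : Measurable T := by fun_prop
  have hRT : IndepFun R T P := by
    refine indepFun_linear_comb hMl hNl hMN _ _ _ _ ?_
    rw [hc]; push_cast; field_simp; ring
  have hX_RT : IndepFun X (fun ω => (R ω, T ω)) P :=
    hX_MN.comp (φ := id)
      (ψ := fun p : ℝ × ℝ => ((1 - c * s) * p.1 + -c * p.2, s * p.1 + 1 * p.2))
      measurable_id (by fun_prop)
  have hR_TX : IndepFun R (fun ω => (T ω, X ω)) P :=
    IndepFun.prodMk_right_of_prodMk_left hRm hTm hX hX_RT.symm hRT
  obtain ⟨w, hw⟩ : ∃ w : ℝ≥0, (w : ℝ) = v / (1 + s ^ 2 * v) := ⟨⟨_, by positivity⟩, rfl⟩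
  have hRl := hasLaw_linear_comb (w := w) hMl hNl hMN (1 - c * s) (-c) (by
    rw [hw, hc]; push_cast; field_simp; ring)
  have hR0 : ∫ ω, R ω ∂P = 0 := by rw [hRl.integral_eq]; simp
  refine ⟨R, c, hRm, hRl.hasGaussianLaw.memLp_two, hR0, ?_, ?_, fun ω => ?_⟩
  · have h := hRl.variance_eq
    rw [variance_of_integral_eq_zero hRm.aemeasurable hR0, variance_id_gaussianReal, hw] at h
    exact h
  · have h := hR_TX.comp (φ := id) (ψ := fun p : ℝ × ℝ => (s * a * p.2 + p.1, p.2))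
      measurable_id (by fun_prop)
    refine h.congr (ae_eq_refl _) (ae_of_all _ fun ω => ?_)
    simp only [hT, Function.comp_apply, Prod.mk.injEq, and_true]
    ring
  · simp only [hR]; ring

/-- Given `X` as well, the error is that of the Gaussian `M` observed through `s M + N`. -/
lemma mmse_channel_side_info {X M N : Ω → ℝ} {v : ℝ≥0} (hX : Measurable X) (hX2 : MemLp X 2 P)
    (hM : Measurable M) (hN : Measurable N) (hMlaw : P.map M = gaussianReal 0 v)
    (hNlaw : P.map N = gaussianReal 0 1)
    (hXM : IndepFun X M P) (hXMN : IndepFun (fun ω => (X ω, M ω)) N P) (a s : ℝ) :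
    mmse (fun ω => a * X ω + M ω) (fun ω => (s * (a * X ω + M ω) + N ω, X ω)) P
      = v / (1 + s ^ 2 * v) := by
  obtain ⟨R, c, hRm, hR2, hR0, hRv, hRi, hRe⟩ :=
    exists_residual hX hM hN hMlaw hNlaw hXM hXMN a s
  have hM2 : MemLp M 2 P :=
    (⟨hM.aemeasurable, hMlaw⟩ : HasLaw M (gaussianReal 0 v) P).hasGaussianLaw.memLp_two
  have hY2 : MemLp (fun ω => a * X ω + M ω) 2 P := (hX2.const_mul a).add hM2
  have hTi : Integrable (fun ω => a * X ω + c * (s * (a * X ω + M ω) + N ω - s * a * X ω)) P :=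
    ((hY2.sub hR2).integrable one_le_two).congr (ae_of_all _ fun ω => by
      simp only [Pi.sub_apply]
      linarith [hRe ω])
  have h := condExp_add_of_indepFun (V := fun ω => (s * (a * X ω + M ω) + N ω, X ω)) (by fun_prop)
    hRm (hR2.integrable one_le_two) hRi
    (t := fun p : ℝ × ℝ => a * p.2 + c * (p.1 - s * a * p.2)) (by fun_prop) hTi
  have h' : P[fun ω => a * X ω + M ω | MeasurableSpace.comap
        (fun ω => (s * (a * X ω + M ω) + N ω, X ω)) inferInstance] =ᵐ[P]
      fun ω => a * X ω + c * (s * (a * X ω + M ω) + N ω - s * a * X ω) + ∫ ω, R ω ∂P :=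
    (condExp_congr_ae (ae_of_all _ hRe)).trans h
  rw [mmse_congr h', ← hRv]
  refine integral_congr_ae (ae_of_all _ fun ω => ?_)
  dsimp only
  rw [hR0]
  congr 1
  linarith [hRe ω]

/-- Knowing `X` as well can only decrease the error of estimating `Y`. -/
lemma le_channelMMSE {X M N : Ω → ℝ} {v : ℝ≥0} (hX : Measurable X) (hX2 : MemLp X 2 P)
    (hM : Measurable M) (hN : Measurable N) (hMlaw : P.map M = gaussianReal 0 v)
    (hNlaw : P.map N = gaussianReal 0 1)
    (hXM : IndepFun X M P) (hXMN : IndepFun (fun ω => (X ω, M ω)) N P) (a s : ℝ) :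
    v / (1 + s ^ 2 * v) ≤ channelMMSE (P.map fun ω => a * X ω + M ω) s := by
  obtain ⟨R, c, hRm, hR2, hR0, hRv, hRi, hRe⟩ :=
    exists_residual hX hM hN hMlaw hNlaw hXM hXMN a s
  have hM2 : MemLp M 2 P :=
    (⟨hM.aemeasurable, hMlaw⟩ : HasLaw M (gaussianReal 0 v) P).hasGaussianLaw.memLp_two
  set Y : Ω → ℝ := fun ω => a * X ω + M ω with hY
  have hYm : Measurable Y := by fun_prop
  have hY2 : MemLp Y 2 P := (hX2.const_mul a).add hM2
  have hYN : IndepFun Y N P :=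
    hXMN.comp (φ := fun p : ℝ × ℝ => a * p.1 + p.2) (ψ := id) (by fun_prop) measurable_id
  have := Measure.isProbabilityMeasure_map (μ := P) hYm.aemeasurable
  have hμ := memLp_id_map hYm hY2
  set e := postAvg (P.map Y) s (fun y => y) with he
  have hem : Measurable e := measurable_postMean hμ s
  have heL : MemLp (fun ω => e (s * Y ω + N ω)) 2 P := by
    have h := memLp_postMean hμ s
    rw [← map_input_noise hYm hN hNlaw hYN] at h
    exact (memLp_map_measure_iff h.aestronglyMeasurable (hYm.prodMk hN).aemeasurable).1 h
  have hval : channelMMSE (P.map Y) s = ∫ ω, (Y ω - e (s * Y ω + N ω)) ^ 2 ∂P := by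
    rw [channelMMSE, ← integral_input_noise hYm hN hNlaw hYN
      (K := fun p => (p.1 - postAvg (P.map Y) s (fun y => y) (s * p.1 + p.2)) ^ 2)
      ((measurable_fst.sub (hem.comp (by fun_prop))).pow_const 2)]
  -- the remaining error is a function of `(s Y + N, X)`, hence independent of `R`
  set D : Ω → ℝ := fun ω =>
    a * X ω + c * (s * Y ω + N ω - s * a * X ω) - e (s * Y ω + N ω) with hD
  have hYRD (ω : Ω) : Y ω - e (s * Y ω + N ω) = R ω + D ω := by
    have := hRe ω
    simp only [hD, hY] at this ⊢
    linarith
  have hD2 : MemLp D 2 P := ((hY2.sub heL).sub hR2).ae_eq (ae_of_all _ fun ω => by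
    simp only [Pi.sub_apply]
    linarith [hYRD ω])
  have hRD : IndepFun R D P := hRi.comp (φ := id)
    (ψ := fun p : ℝ × ℝ => a * p.2 + c * (p.1 - s * a * p.2) - e p.1) measurable_id (by fun_prop)
  have hcross : ∫ ω, R ω * D ω ∂P = 0 := by
    have := hRD.integral_mul_eq_mul_integral hRm.aestronglyMeasurable hD2.aestronglyMeasurable
    simp only [Pi.mul_apply, hR0, zero_mul] at this
    exact this
  have i2 : Integrable (fun ω => R ω * D ω) P := hR2.integrable_mul hD2
  calc (v : ℝ) / (1 + s ^ 2 * v) = ∫ ω, (R ω ^ 2 + 2 * (R ω * D ω)) ∂P := by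
        rw [integral_add hR2.integrable_sq (i2.const_mul 2), integral_const_mul, hcross, hRv]
        ring
    _ ≤ ∫ ω, (Y ω - e (s * Y ω + N ω)) ^ 2 ∂P := by
        refine integral_mono (hR2.integrable_sq.add (i2.const_mul 2))
          (hY2.sub heL).integrable_sq fun ω => ?_
        dsimp only
        rw [hYRD ω]
        nlinarith [sq_nonneg (D ω)]
    _ = _ := hval.symm

lemma covariance_sq_le {U V : Ω → ℝ} (hU : MemLp U 2 P) (hV : MemLp V 2 P) :
    cov[U, V; P] ^ 2 ≤ Var[U; P] * Var[V; P] := by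
  have h (t : ℝ) : 0 ≤ Var[V; P] * (t * t) + 2 * cov[U, V; P] * t + Var[U; P] := by
    have h0 := variance_nonneg (U + fun ω => t * V ω) P
    rw [variance_add hU (hV.const_mul t), variance_const_mul, covariance_const_mul_right] at h0
    linarith
  have := discrim_le_zero h
  rw [discrim] at this
  linarith

lemma variance_channel {X M : Ω → ℝ} {v : ℝ≥0} (hX2 : MemLp X 2 P) (hM : Measurable M)
    (hMlaw : P.map M = gaussianReal 0 v) (hXM : IndepFun X M P) (a : ℝ) :
    Var[fun ω => a * X ω + M ω; P] = a ^ 2 * Var[X; P] + v := by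
  have hMl : HasLaw M (gaussianReal 0 v) P := ⟨hM.aemeasurable, hMlaw⟩
  have hM2 : MemLp M 2 P := hMl.hasGaussianLaw.memLp_two
  have e : (fun ω => a * X ω + M ω) = (fun ω => a * X ω) + M := rfl
  rw [e, variance_add (hX2.const_mul a) hM2, covariance_const_mul_left,
    hXM.covariance_eq_zero hX2 hM2, variance_const_mul, hMl.variance_eq, variance_id_gaussianReal]
  ring

/-- Linear functions attain the one-sided maximal correlation, since `Cov(Y, g(X)) = a Cov(X, g(X))`
for `Y = a X + M`. -/
lemma etaSq_channel {X M : Ω → ℝ} {v : ℝ≥0} (hX2 : MemLp X 2 P) (hM : Measurable M)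
    (hMlaw : P.map M = gaussianReal 0 v) (hXM : IndepFun X M P) (hv : v ≠ 0) (a : ℝ) :
    etaSq X (fun ω => a * X ω + M ω) P = a ^ 2 * Var[X; P] / (a ^ 2 * Var[X; P] + v) := by
  have hv0 : (0 : ℝ) < v := by exact_mod_cast pos_iff_ne_zero.2 hv
  have hMl : HasLaw M (gaussianReal 0 v) P := ⟨hM.aemeasurable, hMlaw⟩
  have hM2 : MemLp M 2 P := hMl.hasGaussianLaw.memLp_two
  have hVX := variance_nonneg X P
  have hcov (g : ℝ → ℝ) (hg : Measurable g) (hg2 : MemLp (fun ω => g (X ω)) 2 P) :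
      cov[fun ω => a * X ω + M ω, fun ω => g (X ω); P] = a * cov[X, fun ω => g (X ω); P] := by
    have e : (fun ω => a * X ω + M ω) = (fun ω => a * X ω) + M := rfl
    have hi : IndepFun M (fun ω => g (X ω)) P :=
      hXM.symm.comp (φ := id) (ψ := g) measurable_id hg
    rw [e, covariance_add_left (hX2.const_mul a) hM2 hg2, covariance_const_mul_left,
      hi.covariance_eq_zero hM2 hg2, add_zero]
  have hvY := variance_channel hX2 hM hMlaw hXM a
  have hpos : 0 < a ^ 2 * Var[X; P] + v := by positivity
  refine IsGreatest.csSup_eq ⟨⟨fun x => x, measurable_id, hX2, ?_⟩, ?_⟩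
  · rw [corrSq, hcov (fun x => x) measurable_id hX2, hvY, covariance_self hX2.aemeasurable]
    rcases eq_or_ne (Var[X; P]) 0 with h | h
    · simp [h]
    · field_simp
  · rintro _ ⟨g, hg, hg2, rfl⟩
    rw [corrSq, hcov g hg hg2, hvY]
    have hcs := covariance_sq_le hX2 hg2
    rcases (variance_nonneg (fun ω => g (X ω)) P).eq_or_lt with h | h
    · rw [← h]
      simp only [mul_zero, div_zero]
      positivity
    · rw [div_le_div_iff₀ (by positivity) hpos]
      have : (a * cov[X, fun ω => g (X ω); P]) ^ 2
          ≤ a ^ 2 * (Var[X; P] * Var[fun ω => g (X ω); P]) := by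
        rw [mul_pow]
        exact mul_le_mul_of_nonneg_left hcs (sq_nonneg a)
      calc _ ≤ a ^ 2 * (Var[X; P] * Var[fun ω => g (X ω); P]) * (a ^ 2 * Var[X; P] + v) :=
            mul_le_mul_of_nonneg_right this hpos.le
        _ = _ := by ring

end

/-! ### Maximal gain under a cost constraint -/

/-- The largest gain `F γ` over all `γ ≥ 0` whose cost `G γ` is at most `ε`. -/
noncomputable def maxGain (F G : ℝ → ℝ) (ε : ℝ≥0) : ℝ≥0∞ :=
  sSup ((fun γ : ℝ => ENNReal.ofReal (F γ)) '' {γ : ℝ | 0 ≤ γ ∧ ENNReal.ofReal (G γ) ≤ ε})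

section

variable {F G F' G' : ℝ → ℝ}

lemma ofReal_le_maxGain {γ : ℝ} {ε : ℝ≥0} (hγ : 0 ≤ γ) (h : G γ ≤ ε) :
    ENNReal.ofReal (F γ) ≤ maxGain F G ε :=
  le_sSup ⟨γ, ⟨hγ, by rwa [ENNReal.ofReal_le_iff_le_toReal ENNReal.coe_ne_top,
    ENNReal.coe_toReal]⟩, rfl⟩

lemma maxGain_mono {ε₁ ε₂ : ℝ≥0} (h : ε₁ ≤ ε₂) : maxGain F G ε₁ ≤ maxGain F G ε₂ :=
  sSup_le_sSup (Set.image_mono fun _ hγ => ⟨hγ.1, hγ.2.trans (by exact_mod_cast h)⟩)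

lemma cost_le_of_ofReal_le {γ : ℝ} {ε : ℝ≥0} (h : ENNReal.ofReal (G γ) ≤ ε) : G γ ≤ ε := by
  rwa [ENNReal.ofReal_le_iff_le_toReal ENNReal.coe_ne_top, ENNReal.coe_toReal] at h

lemma exists_maxGain_eq (hF : Continuous F) (hG : Continuous G) (hG0 : G 0 = 0)
    (hGm : MonotoneOn G (Set.Ici 0)) {ε : ℝ≥0} {x : ℝ} (hx : 0 ≤ x) (hGx : ε < G x) :
    maxGain F G ε ≠ ∞ ∧ ∃ γ : ℝ, 0 ≤ γ ∧ ENNReal.ofReal (G γ) ≤ ε ∧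
      ENNReal.ofReal (F γ) = maxGain F G ε := by
  set S : Set ℝ := {γ : ℝ | 0 ≤ γ ∧ ENNReal.ofReal (G γ) ≤ ε} with hS
  have hSx : S ⊆ Set.Icc 0 x := fun γ hγ => ⟨hγ.1, by
    by_contra! h
    have := hGm hx hγ.1 h.le
    linarith [cost_le_of_ofReal_le hγ.2]⟩
  have hSc : IsClosed S := isClosed_Ici.inter
    (isClosed_le (ENNReal.continuous_ofReal.comp hG) continuous_const)
  have hScomp : IsCompact S := isCompact_Icc.of_isClosed_subset hSc hSx
  obtain ⟨γ, hγS, hγ⟩ := hScomp.exists_isMaxOn ⟨0, le_rfl, by simp [hG0]⟩ hF.continuousOn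
  have heq : ENNReal.ofReal (F γ) = maxGain F G ε := by
    refine le_antisymm (le_sSup ⟨γ, hγS, rfl⟩) (sSup_le ?_)
    rintro _ ⟨δ, hδ, rfl⟩
    exact ENNReal.ofReal_le_ofReal (hγ hδ)
  exact ⟨heq ▸ ENNReal.ofReal_ne_top, γ, hγS.1, hγS.2, heq⟩

/-- If the cost is at most `η` times the gain, then `ε / η` can be gained. -/
lemma div_le_maxGain (hG : Continuous G) (hG0 : G 0 = 0) {η : ℝ} (hη : 0 ≤ η)
    (hGF : ∀ γ, 0 ≤ γ → G γ ≤ η * F γ) {ε : ℝ≥0} {x : ℝ} (hx : 0 ≤ x) (hGx : ε < G x) :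
    (ε : ℝ≥0∞) / ENNReal.ofReal η ≤ maxGain F G ε := by
  obtain ⟨γ, hγ, hγε⟩ := intermediate_value_Icc hx hG.continuousOn
    (show (ε : ℝ) ∈ Set.Icc (G 0) (G x) from ⟨by rw [hG0]; exact ε.2, hGx.le⟩)
  refine ENNReal.div_le_of_le_mul ?_
  calc (ε : ℝ≥0∞) = ENNReal.ofReal (G γ) := by rw [hγε, ENNReal.ofReal_coe_nnreal]
    _ ≤ ENNReal.ofReal (η * F γ) := ENNReal.ofReal_le_ofReal (hGF γ hγ.1)
    _ = ENNReal.ofReal (F γ) * ENNReal.ofReal η := by rw [ENNReal.ofReal_mul hη, mul_comm]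
    _ ≤ _ := mul_le_mul_left (ofReal_le_maxGain hγ.1 hγε.le) _

lemma monotoneOn_Ici_of_hasDerivAt (hF : Continuous F)
    (hF' : ∀ x, 0 < x → HasDerivAt F (F' x) x) (h0 : ∀ x, 0 < x → 0 ≤ F' x) :
    MonotoneOn F (Set.Ici 0) := by
  refine monotoneOn_of_deriv_nonneg (convex_Ici 0) hF.continuousOn ?_ ?_
  · rw [interior_Ici]
    exact fun x hx => (hF' x hx).differentiableAt.differentiableWithinAt
  · rw [interior_Ici]
    intro x hx
    rw [(hF' x hx).deriv]
    exact h0 x hx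

/-- If `F' / G'` is nondecreasing, then so are the slopes of `F` against `G`
(by Cauchy's mean value theorem). -/
lemma mul_sub_le_mul_sub (hF : Continuous F) (hG : Continuous G)
    (hF' : ∀ x, 0 < x → HasDerivAt F (F' x) x) (hG' : ∀ x, 0 < x → HasDerivAt G (G' x) x)
    (hFpos : ∀ x, 0 < x → 0 < F' x) (hGnn : ∀ x, 0 < x → 0 ≤ G' x)
    (hratio : ∀ x y, 0 < x → x ≤ y → F' x * G' y ≤ F' y * G' x) {a b c : ℝ} (ha : 0 ≤ a)
    (hab : a < b) (hbc : b ≤ c) (hGab : G a < G b) :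
    (F b - F a) * (G c - G b) ≤ (F c - F b) * (G b - G a) := by
  rcases hbc.eq_or_lt with rfl | hbc
  · simp
  have hb : 0 < b := ha.trans_lt hab
  obtain ⟨x, hx, hxe⟩ := exists_ratio_hasDerivAt_eq_ratio_slope F F' hab hF.continuousOn
    (fun y hy => hF' y (ha.trans_lt hy.1)) G G' hG.continuousOn
    (fun y hy => hG' y (ha.trans_lt hy.1))
  obtain ⟨y, hy, hye⟩ := exists_ratio_hasDerivAt_eq_ratio_slope F F' hbc hF.continuousOn
    (fun y hy => hF' y (hb.trans hy.1)) G G' hG.continuousOn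
    (fun y hy => hG' y (hb.trans hy.1))
  have hx0 : 0 < x := ha.trans_lt hx.1
  have hy0 : 0 < y := hb.trans hy.1
  have hFx := hFpos x hx0
  have hFy := hFpos y hy0
  have hd : 0 < G b - G a := by linarith
  have hFbc : F b ≤ F c := monotoneOn_Ici_of_hasDerivAt hF hF' (fun x hx => (hFpos x hx).le)
    hb.le (hb.le.trans hbc.le) hbc.le
  have hGbc : G b ≤ G c := monotoneOn_Ici_of_hasDerivAt hG hG' hGnn
    hb.le (hb.le.trans hbc.le) hbc.le
  have hGx : 0 < G' x := by
    rcases (hGnn x hx0).eq_or_lt with h | h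
    · rw [← h, mul_zero] at hxe
      exact absurd hxe (mul_pos hd hFx).ne'
    · exact h
  rcases (hGnn y hy0).eq_or_lt with h | hGy
  · rw [← h, mul_zero] at hye
    have : G c - G b = 0 := (mul_eq_zero.1 hye).resolve_right hFy.ne'
    rw [this, mul_zero]
    exact mul_nonneg (by linarith) hd.le
  · refine le_of_mul_le_mul_right ?_ (mul_pos hGx hGy)
    calc (F b - F a) * (G c - G b) * (G' x * G' y)
        = ((F b - F a) * G' x) * (G c - G b) * G' y := by ring
      _ = (G b - G a) * (G c - G b) * (F' x * G' y) := by rw [← hxe]; ring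
      _ ≤ (G b - G a) * (G c - G b) * (F' y * G' x) :=
          mul_le_mul_of_nonneg_left (hratio x y hx0 (hx.2.trans hy.1).le)
            (mul_nonneg hd.le (by linarith))
      _ = ((G c - G b) * F' y) * (G b - G a) * G' x := by ring
      _ = (F c - F b) * (G b - G a) * (G' x * G' y) := by rw [hye]; ring

/-- The maximal gain is a convex function of the admissible cost if `F' / G'` is nondecreasing. -/
theorem convexOn_maxGain (hF : Continuous F) (hG : Continuous G) (hG0 : G 0 = 0)
    (hFtop : Tendsto F atTop atTop) (hFnn : ∀ x, 0 ≤ x → 0 ≤ F x)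
    (hF' : ∀ x, 0 < x → HasDerivAt F (F' x) x) (hG' : ∀ x, 0 < x → HasDerivAt G (G' x) x)
    (hFpos : ∀ x, 0 < x → 0 < F' x) (hGnn : ∀ x, 0 < x → 0 ≤ G' x)
    (hratio : ∀ x y, 0 < x → x ≤ y → F' x * G' y ≤ F' y * G' x) :
    ConvexOn ℝ≥0 Set.univ (maxGain F G) := by
  have hFm := monotoneOn_Ici_of_hasDerivAt hF hF' fun x hx => (hFpos x hx).le
  have hGm := monotoneOn_Ici_of_hasDerivAt hG hG' hGnn
  have key (ε₁ ε₂ α β : ℝ≥0) (hαβ : α + β = 1) (h12 : ε₁ ≤ ε₂) :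
      maxGain F G (α * ε₁ + β * ε₂) ≤ α * maxGain F G ε₁ + β * maxGain F G ε₂ := by
    have hαβ' : (α : ℝ) + β = 1 := by exact_mod_cast hαβ
    have h12' : (ε₁ : ℝ) ≤ ε₂ := by exact_mod_cast h12
    have hle : maxGain F G ε₁ ≤ α * maxGain F G ε₁ + β * maxGain F G ε₂ := by
      calc maxGain F G ε₁ = ((α + β : ℝ≥0) : ℝ≥0∞) * maxGain F G ε₁ := by simp [hαβ]
        _ = α * maxGain F G ε₁ + β * maxGain F G ε₁ := by rw [ENNReal.coe_add, add_mul]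
        _ ≤ _ := by gcongr; exact maxGain_mono h12
    refine sSup_le ?_
    rintro _ ⟨γ, ⟨hγ, hGγ⟩, rfl⟩
    have hGγ' := cost_le_of_ofReal_le hGγ
    push_cast at hGγ'
    dsimp only
    rcases le_or_gt (G γ) ε₁ with h1 | h1
    · exact (ofReal_le_maxGain hγ h1).trans hle
    have hβ : β ≠ 0 := by
      rintro rfl
      have hα : (α : ℝ) = 1 := by simpa using hαβ'
      rw [hα] at hGγ'
      simp at hGγ'
      linarith
    by_cases hx : ∃ x, 0 ≤ x ∧ ε₂ < G x
    · obtain ⟨x, hx0, hx⟩ := hx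
      have hγε : G γ ≤ ε₂ := by nlinarith [α.2, β.2, NNReal.coe_nonneg α, NNReal.coe_nonneg β]
      have hγx : γ ≤ x := by
        by_contra! h
        linarith [hGm hx0 hγ h.le]
      obtain ⟨γ₁, hγ₁, e₁⟩ := intermediate_value_Icc hγ hG.continuousOn
        (show (ε₁ : ℝ) ∈ Set.Icc (G 0) (G γ) from ⟨by rw [hG0]; exact ε₁.2, h1.le⟩)
      obtain ⟨γ₂, hγ₂, e₂⟩ := intermediate_value_Icc hγx hG.continuousOn
        (show (ε₂ : ℝ) ∈ Set.Icc (G γ) (G x) from ⟨hγε, hx.le⟩)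
      have hlt : γ₁ < γ := lt_of_le_of_ne hγ₁.2 (by rintro rfl; linarith)
      have hs := mul_sub_le_mul_sub hF hG hF' hG' hFpos hGnn hratio hγ₁.1 hlt hγ₂.1 (by linarith)
      rw [e₁, e₂] at hs
      have hF1 : F γ₁ ≤ F γ := hFm hγ₁.1 hγ hlt.le
      have hA : 0 < G γ - ε₁ := by linarith
      have hconv : F γ ≤ α * F γ₁ + β * F γ₂ := by
        have h3 : (α : ℝ) * (G γ - ε₁) ≤ β * (ε₂ - G γ) := by
          have : (α : ℝ) * G γ + β * G γ = G γ := by rw [← add_mul, hαβ', one_mul]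
          linarith
        have h4 : (α : ℝ) * (F γ - F γ₁) ≤ β * (F γ₂ - F γ) := by
          refine le_of_mul_le_mul_right ?_ hA
          calc (α : ℝ) * (F γ - F γ₁) * (G γ - ε₁) = α * (G γ - ε₁) * (F γ - F γ₁) := by ring
            _ ≤ β * (ε₂ - G γ) * (F γ - F γ₁) := mul_le_mul_of_nonneg_right h3 (by linarith)
            _ = β * ((F γ - F γ₁) * (ε₂ - G γ)) := by ring
            _ ≤ β * ((F γ₂ - F γ) * (G γ - ε₁)) := mul_le_mul_of_nonneg_left hs β.2
            _ = _ := by ring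
        have : (α : ℝ) * F γ + β * F γ = F γ := by rw [← add_mul, hαβ', one_mul]
        linarith
      calc ENNReal.ofReal (F γ) ≤ ENNReal.ofReal (α * F γ₁ + β * F γ₂) :=
            ENNReal.ofReal_le_ofReal hconv
        _ = α * ENNReal.ofReal (F γ₁) + β * ENNReal.ofReal (F γ₂) := by
            have n1 := hFnn γ₁ hγ₁.1
            have n2 := hFnn γ₂ (hγ.trans hγ₂.1)
            rw [ENNReal.ofReal_add (by positivity) (by positivity),
              ENNReal.ofReal_mul (NNReal.coe_nonneg α), ENNReal.ofReal_mul (NNReal.coe_nonneg β),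
              ENNReal.ofReal_coe_nnreal, ENNReal.ofReal_coe_nnreal]
        _ ≤ _ := by
            gcongr
            · exact ofReal_le_maxGain hγ₁.1 e₁.le
            · exact ofReal_le_maxGain (hγ.trans hγ₂.1) e₂.le
    · -- every `γ` is admissible at cost `ε₂`, so the gain is unbounded
      push Not at hx
      have htop : maxGain F G ε₂ = ∞ := by
        refine ENNReal.eq_top_of_forall_nnreal_le fun r => ?_
        obtain ⟨x, hx0, hFx⟩ := ((eventually_ge_atTop 0).and
          (hFtop.eventually_ge_atTop (r : ℝ))).exists
        refine le_trans ?_ (ofReal_le_maxGain hx0 (hx x hx0))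
        rw [← ENNReal.ofReal_coe_nnreal]
        exact ENNReal.ofReal_le_ofReal hFx
      rw [htop, ENNReal.mul_top (by exact_mod_cast hβ), add_top]
      exact le_top
  refine ⟨convex_univ, fun ε₁ _ ε₂ _ α β _ _ hαβ => ?_⟩
  simp only [smul_eq_mul, ENNReal.smul_def]
  rcases le_total ε₁ ε₂ with h | h
  · exact key ε₁ ε₂ α β hαβ h
  · rw [add_comm (α * ε₁), add_comm ((α : ℝ≥0∞) * _)]
    exact key ε₂ ε₁ β α (by rwa [add_comm]) h

end

/-! ### The two mutual informations of the additive noise model -/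

/-- The mutual information `I(X; s Y + N)` for `Y = a X + M`, where `X ∼ ν`, `M ∼ 𝒩(0, v)` and
`N ∼ 𝒩(0, 1)` are independent: relative to `X`, the total noise `s M + N` has variance
`s² v + 1`. -/
noncomputable def leakage (ν : Measure ℝ) (a v s : ℝ) : ℝ :=
  channelInfo ν (s * a / √(s ^ 2 * v + 1))

section

variable {Ω : Type*} [MeasurableSpace Ω] {P : Measure Ω} [IsProbabilityMeasure P]
  {X M N : Ω → ℝ} {v : ℝ≥0}

lemma continuous_leakage {ν : Measure ℝ} [IsProbabilityMeasure ν] (hν : MemLp id 2 ν) (a : ℝ) :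
    Continuous (leakage ν a v) := by
  refine (continuous_channelInfo hν).comp (Continuous.div (by fun_prop) (by fun_prop) fun s => ?_)
  have : 0 < s ^ 2 * (v : ℝ) + 1 := by positivity
  exact (Real.sqrt_pos.2 this).ne'

lemma leakage_zero {ν : Measure ℝ} [IsProbabilityMeasure ν] (a : ℝ) :
    leakage ν a v 0 = 0 := by
  simp [leakage, channelInfo_zero]

/-- As the amplitude tends to infinity, the observation noise `N` becomes negligible. -/
lemma tendsto_leakage {ν : Measure ℝ} [IsProbabilityMeasure ν] (hν : MemLp id 2 ν) (a : ℝ)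
    (hv : v ≠ 0) : Tendsto (leakage ν a v) atTop (𝓝 (channelInfo ν (a / √v))) := by
  have hv0 : (0 : ℝ) < v := by exact_mod_cast pos_iff_ne_zero.2 hv
  refine ((continuous_channelInfo hν).tendsto _).comp ?_
  have h1 : Tendsto (fun s : ℝ => a / √(v + (s⁻¹) ^ 2)) atTop (𝓝 (a / √(v + 0 ^ 2))) := by
    refine tendsto_const_nhds.div ?_ (by simpa using (Real.sqrt_pos.2 hv0).ne')
    exact (Real.continuous_sqrt.tendsto _).comp
      (tendsto_const_nhds.add (tendsto_inv_atTop_zero.pow 2))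
  simp only [ne_eq, OfNat.ofNat_ne_zero, not_false_eq_true, zero_pow, add_zero] at h1
  refine h1.congr' ?_
  filter_upwards [eventually_gt_atTop 0] with s hs
  have e : √(s ^ 2 * (v : ℝ) + 1) = s * √(v + (s⁻¹) ^ 2) := by
    rw [← Real.sqrt_sq hs.le, ← Real.sqrt_mul (sq_nonneg s), Real.sqrt_sq hs.le]
    congr 1
    field_simp
  rw [e, mul_div_mul_left _ _ hs.ne']

/-- The law of the total noise `s M + N` relative to the input `X`. -/
lemma total_noise (hX : Measurable X) (hM : Measurable M) (hN : Measurable N)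
    (hMlaw : P.map M = gaussianReal 0 v) (hNlaw : P.map N = gaussianReal 0 1)
    (hXM : IndepFun X M P) (hXMN : IndepFun (fun ω => (X ω, M ω)) N P) (s : ℝ) :
    ∃ w : ℝ≥0, (w : ℝ) = s ^ 2 * v + 1 ∧ P.map (fun ω => s * M ω + N ω) = gaussianReal 0 w ∧
      IndepFun X (fun ω => s * M ω + N ω) P := by
  have hMN : IndepFun M N P := hXMN.comp (φ := Prod.snd) (ψ := id) measurable_snd measurable_id
  obtain ⟨w, hw⟩ : ∃ w : ℝ≥0, (w : ℝ) = s ^ 2 * v + 1 := ⟨⟨_, by positivity⟩, rfl⟩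
  refine ⟨w, hw, ?_, ?_⟩
  · have h := hasLaw_linear_comb (w := w) ⟨hM.aemeasurable, hMlaw⟩ ⟨hN.aemeasurable, hNlaw⟩ hMN s 1
      (by rw [hw]; simp)
    simpa using h.map_eq
  · exact (IndepFun.prodMk_right_of_prodMk_left hX hM hN hXMN hXM).comp (φ := id)
      (ψ := fun p : ℝ × ℝ => s * p.1 + p.2) measurable_id (by fun_prop)

lemma mutualInfo_eq_leakage (hX : Measurable X) (hX2 : MemLp X 2 P) (hM : Measurable M)
    (hN : Measurable N) (hMlaw : P.map M = gaussianReal 0 v) (hNlaw : P.map N = gaussianReal 0 1)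
    (hXM : IndepFun X M P) (hXMN : IndepFun (fun ω => (X ω, M ω)) N P) (a s : ℝ) :
    mutualInfo X (fun ω => s * (a * X ω + M ω) + N ω) P
      = ENNReal.ofReal (leakage (P.map X) a v s) ∧ 0 ≤ leakage (P.map X) a v s := by
  obtain ⟨w, hw, hlaw, hind⟩ := total_noise hX hM hN hMlaw hNlaw hXM hXMN s
  have hw0 : w ≠ 0 := by
    rintro rfl
    have : 0 < s ^ 2 * (v : ℝ) + 1 := by positivity
    simp at hw
    linarith
  have h := mutualInfo_gaussian_channel hX hX2 (by fun_prop) hlaw hind hw0 (s * a)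
  have e : (fun ω => s * (a * X ω + M ω) + N ω) = fun ω => s * a * X ω + (s * M ω + N ω) := by
    ext ω; ring
  rw [leakage, e, ← hw]
  exact h

/-- Both mutual informations are the entropy of the output minus the entropy of a Gaussian noise. -/
lemma leakage_eq_sub (hX : Measurable X) (hX2 : MemLp X 2 P) (hM : Measurable M)
    (hN : Measurable N) (hMlaw : P.map M = gaussianReal 0 v) (hNlaw : P.map N = gaussianReal 0 1)
    (hXM : IndepFun X M P) (hXMN : IndepFun (fun ω => (X ω, M ω)) N P) (a s : ℝ) :
    leakage (P.map X) a v s = channelInfo (P.map fun ω => a * X ω + M ω) s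
      - Real.log (1 + s ^ 2 * v) / 2 := by
  obtain ⟨w, hw, hlaw, hind⟩ := total_noise hX hM hN hMlaw hNlaw hXM hXMN s
  have hpos : 0 < s ^ 2 * (v : ℝ) + 1 := by positivity
  have hw0 : w ≠ 0 := by
    rintro rfl
    simp at hw
    linarith
  have hM2 : MemLp M 2 P :=
    (⟨hM.aemeasurable, hMlaw⟩ : HasLaw M (gaussianReal 0 v) P).hasGaussianLaw.memLp_two
  have hY2 : MemLp (fun ω => a * X ω + M ω) 2 P := (hX2.const_mul a).add hM2
  have hYN : IndepFun (fun ω => a * X ω + M ω) N P :=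
    hXMN.comp (φ := fun p : ℝ × ℝ => a * p.1 + p.2) (ψ := id) (by fun_prop) measurable_id
  have h1 := channelInfo_eq_diffEntropy hX hX2 (by fun_prop) hlaw hind hw0 (s * a)
  have h2 := channelInfo_eq_diffEntropy (by fun_prop) hY2 hN hNlaw hYN one_ne_zero s
  have e : (fun ω => s * (a * X ω + M ω) + N ω) = fun ω => s * a * X ω + (s * M ω + N ω) := by
    ext ω; ring
  rw [e] at h2
  simp only [NNReal.coe_one, Real.sqrt_one, div_one, mul_one] at h2
  rw [leakage, ← hw, h1, h2, hw, Real.log_mul (by positivity) hpos.ne',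
    add_comm 1 (s ^ 2 * (v : ℝ))]
  ring

lemma mutualInfo_input_eq (hX : Measurable X) (hX2 : MemLp X 2 P) (hM : Measurable M)
    (hN : Measurable N) (hMlaw : P.map M = gaussianReal 0 v) (hNlaw : P.map N = gaussianReal 0 1)
    (hXMN : IndepFun (fun ω => (X ω, M ω)) N P) (a s : ℝ) :
    mutualInfo (fun ω => a * X ω + M ω) (fun ω => s * (a * X ω + M ω) + N ω) P
        = ENNReal.ofReal (channelInfo (P.map fun ω => a * X ω + M ω) s) ∧
      0 ≤ channelInfo (P.map fun ω => a * X ω + M ω) s := by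
  have hM2 : MemLp M 2 P :=
    (⟨hM.aemeasurable, hMlaw⟩ : HasLaw M (gaussianReal 0 v) P).hasGaussianLaw.memLp_two
  have hY2 : MemLp (fun ω => a * X ω + M ω) 2 P := (hX2.const_mul a).add hM2
  have hYN : IndepFun (fun ω => a * X ω + M ω) N P :=
    hXMN.comp (φ := fun p : ℝ × ℝ => a * p.1 + p.2) (ψ := id) (by fun_prop) measurable_id
  simpa using mutualInfo_gaussian_channel (by fun_prop) hY2 hN hNlaw hYN one_ne_zero s

lemma hasDerivAt_channelInfo_sqrt {μ : Measure ℝ} [IsProbabilityMeasure μ] (hμ : MemLp id 2 μ)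
    {γ : ℝ} (hγ : 0 < γ) :
    HasDerivAt (fun γ => channelInfo μ √γ) (channelMMSE μ √γ / 2) γ := by
  have hs := Real.sqrt_pos.2 hγ
  refine ((hasDerivAt_channelInfo hμ hs).comp γ (Real.hasDerivAt_sqrt hγ.ne')).congr_deriv ?_
  field_simp

/-- The mean value theorem, with a derivative that is nonincreasing in `γ`. -/
lemma mul_channelMMSE_le_channelInfo {μ : Measure ℝ} [IsProbabilityMeasure μ] (hμ : MemLp id 2 μ)
    {γ : ℝ} (hγ : 0 < γ) : γ * channelMMSE μ √γ / 2 ≤ channelInfo μ √γ := by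
  have hc : Continuous fun γ => channelInfo μ √γ :=
    (continuous_channelInfo hμ).comp Real.continuous_sqrt
  obtain ⟨c, hcm, hce⟩ := exists_hasDerivAt_eq_slope (fun γ => channelInfo μ √γ)
    (fun γ => channelMMSE μ √γ / 2) hγ hc.continuousOn
    fun x hx => hasDerivAt_channelInfo_sqrt hμ hx.1
  rw [Real.sqrt_zero, channelInfo_zero, sub_zero, sub_zero, eq_div_iff hγ.ne'] at hce
  have := antitone_channelMMSE hμ (Real.sqrt_nonneg c) (Real.sqrt_le_sqrt hcm.2.le)
  nlinarith

lemma channelMMSE_sqrt_le_div {μ : Measure ℝ} [IsProbabilityMeasure μ] (hμ : MemLp id 2 μ)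
    {x y : ℝ} (hx : 0 ≤ x) (hxy : x ≤ y) (hy : 0 < y) :
    channelMMSE μ √y ≤ channelMMSE μ √x / (1 + (y - x) * channelMMSE μ √x) := by
  have h := channelMMSE_le_div hμ (s₁ := √x) (d := √(y - x)) (Real.sqrt_pos.2 hy)
    (by rw [Real.sq_sqrt hy.le, Real.sq_sqrt hx, Real.sq_sqrt (by linarith)]; ring)
  rwa [Real.sq_sqrt (by linarith)] at h

end

end RatePrivacy

theorem theorem2 {Ω : Type*} [MeasurableSpace Ω] (P : Measure Ω) [IsProbabilityMeasure P]
    (X Y M N : Ω → ℝ) (a : ℝ) (σM : ℝ≥0) (hσM : 0 < σM)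
    (hX : Measurable X) (hX2 : MemLp X 2 P)
    (hM : Measurable M) (hMlaw : P.map M = gaussianReal 0 (σM ^ 2)) (hXM : IndepFun X M P)
    (hY : Y = fun ω => a * X ω + M ω)
    (hN : Measurable N) (hNlaw : P.map N = gaussianReal 0 1)
    (hXYN : IndepFun (fun ω => (X ω, Y ω)) N P) :
    -- for `ε < I(X; Y)` the supremum defining `g_ε` is a finite maximum
    (∀ ε : ℝ≥0, (ε : ℝ≥0∞) < RatePrivacy.mutualInfo X Y P →
      RatePrivacy.ratePrivacy X Y N P ε ≠ ∞ ∧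
      ∃ γ : ℝ, 0 ≤ γ ∧ RatePrivacy.mutualInfo X (RatePrivacy.chanOut Y N γ) P ≤ ε ∧
        RatePrivacy.mutualInfo Y (RatePrivacy.chanOut Y N γ) P
          = RatePrivacy.ratePrivacy X Y N P ε) ∧
    -- part 1: convexity on `[0, ∞)`, as a function with values in `[0, ∞]`
    ((σM : ℝ) ^ 2 ≤ a ^ 2 * Var[X; P] →
      ConvexOn ℝ≥0 Set.univ (RatePrivacy.ratePrivacy X Y N P)) ∧
    -- part 2
    (0 < a →
      (∀ ε : ℝ≥0, (ε : ℝ≥0∞) < RatePrivacy.mutualInfo X Y P →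
        (ε : ℝ≥0∞) / ENNReal.ofReal (RatePrivacy.etaSq X Y P)
          ≤ RatePrivacy.ratePrivacy X Y N P ε) ∧
      ((∀ γ : ℝ, 0 ≤ γ → 0 < RatePrivacy.mmse Y (RatePrivacy.chanOut Y N γ) P) ∧
        IsGLB ((fun γ : ℝ =>
            RatePrivacy.mmse Y (fun ω => (RatePrivacy.chanOut Y N γ ω, X ω)) P
              / RatePrivacy.mmse Y (RatePrivacy.chanOut Y N γ) P) '' Set.Ici 0)
          (1 - RatePrivacy.etaSq X Y P)) ∧
      ((∀ γ : ℝ, 0 < γ →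
          RatePrivacy.mutualInfo Y (RatePrivacy.chanOut Y N γ) P ≠ 0 ∧
          RatePrivacy.mutualInfo Y (RatePrivacy.chanOut Y N γ) P ≠ ∞) ∧
        IsLUB ((fun γ : ℝ =>
            RatePrivacy.mutualInfo X (RatePrivacy.chanOut Y N γ) P
              / RatePrivacy.mutualInfo Y (RatePrivacy.chanOut Y N γ) P) '' Set.Ioi 0)
          (ENNReal.ofReal (RatePrivacy.etaSq X Y P)))) := by
  open RatePrivacy Filter Topology in
  subst hY
  obtain ⟨v, hv⟩ : ∃ v : ℝ≥0, v = σM ^ 2 := ⟨_, rfl⟩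
  rw [← hv] at hMlaw
  have hvne : v ≠ 0 := by rw [hv]; positivity
  have hv0 : (0 : ℝ) < v := by exact_mod_cast pos_iff_ne_zero.2 hvne
  set Y : Ω → ℝ := fun ω => a * X ω + M ω with hYdef
  have hYm : Measurable Y := by fun_prop
  have hM2 : MemLp M 2 P :=
    (⟨hM.aemeasurable, hMlaw⟩ : HasLaw M (gaussianReal 0 v) P).hasGaussianLaw.memLp_two
  have hY2 : MemLp Y 2 P := (hX2.const_mul a).add hM2
  have hXMN : IndepFun (fun ω => (X ω, M ω)) N P := by
    have h := hXYN.comp (φ := fun p : ℝ × ℝ => (p.1, p.2 - a * p.1)) (ψ := id) (by fun_prop)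
      measurable_id
    refine h.congr (ae_of_all _ fun ω => ?_) (ae_eq_refl _)
    simp [hYdef]
  have hYN : IndepFun Y N P := hXYN.comp (φ := Prod.snd) (ψ := id) measurable_snd measurable_id
  have := Measure.isProbabilityMeasure_map (μ := P) hX.aemeasurable
  have := Measure.isProbabilityMeasure_map (μ := P) hYm.aemeasurable
  have hνX := memLp_id_map hX hX2
  have hνY := memLp_id_map hYm hY2
  -- the two mutual informations as functions of `γ`
  set F : ℝ → ℝ := fun γ => channelInfo (P.map Y) √γ with hF
  set G : ℝ → ℝ := fun γ => leakage (P.map X) a v √γ with hG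
  set m : ℝ → ℝ := fun γ => channelMMSE (P.map Y) √γ with hm
  set l : ℝ → ℝ := fun γ => v / (1 + γ * v) with hl
  have hFI (γ : ℝ) : mutualInfo Y (chanOut Y N γ) P = ENNReal.ofReal (F γ) ∧ 0 ≤ F γ :=
    mutualInfo_input_eq hX hX2 hM hN hMlaw hNlaw hXMN a √γ
  have hGI (γ : ℝ) : mutualInfo X (chanOut Y N γ) P = ENNReal.ofReal (G γ) ∧ 0 ≤ G γ :=
    mutualInfo_eq_leakage hX hX2 hM hN hMlaw hNlaw hXM hXMN a √γ
  have hGF {γ : ℝ} (hγ : 0 ≤ γ) : G γ = F γ - Real.log (1 + γ * v) / 2 := by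
    have h := leakage_eq_sub hX hX2 hM hN hMlaw hNlaw hXM hXMN a √γ
    rwa [Real.sq_sqrt hγ] at h
  have hrp : ratePrivacy X Y N P = maxGain F G := by
    ext1 ε
    simp only [ratePrivacy, maxGain, (hFI _).1, (hGI _).1]
  have hFc : Continuous F := (continuous_channelInfo hνY).comp Real.continuous_sqrt
  have hGc : Continuous G := (continuous_leakage hνX a).comp Real.continuous_sqrt
  have hF0 : F 0 = 0 := by simp [hF, channelInfo_zero]
  have hG0 : G 0 = 0 := by simp [hG, leakage_zero]
  have hml {γ : ℝ} (hγ : 0 ≤ γ) : l γ ≤ m γ := by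
    have h := le_channelMMSE hX hX2 hM hN hMlaw hNlaw hXM hXMN a √γ
    rwa [Real.sq_sqrt hγ] at h
  have hlpos {γ : ℝ} (hγ : 0 ≤ γ) : 0 < l γ := by positivity
  have hmpos {γ : ℝ} (hγ : 0 ≤ γ) : 0 < m γ := (hlpos hγ).trans_le (hml hγ)
  have hF' (γ : ℝ) (hγ : 0 < γ) : HasDerivAt F (m γ / 2) γ := hasDerivAt_channelInfo_sqrt hνY hγ
  have hG' (γ : ℝ) (hγ : 0 < γ) : HasDerivAt G (m γ / 2 - l γ / 2) γ := by
    have hpos : 0 < 1 + γ * v := by positivity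
    have h1 : HasDerivAt (fun γ : ℝ => 1 + γ * v) (v : ℝ) γ := by
      simpa using ((hasDerivAt_id γ).mul_const (v : ℝ)).const_add 1
    have h := (hF' γ hγ).sub ((h1.log hpos.ne').div_const 2)
    refine h.congr_of_eventuallyEq ?_
    filter_upwards [eventually_gt_nhds hγ] with δ hδ
    exact hGF hδ.le
  have hGnn (γ : ℝ) (hγ : 0 < γ) : 0 ≤ m γ / 2 - l γ / 2 := by linarith [hml hγ.le]
  have hGm : MonotoneOn G (Set.Ici 0) := monotoneOn_Ici_of_hasDerivAt hGc hG' hGnn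
  have hratio (x y : ℝ) (hx : 0 < x) (hxy : x ≤ y) :
      m x / 2 * (m y / 2 - l y / 2) ≤ m y / 2 * (m x / 2 - l x / 2) := by
    have hd : 0 ≤ y - x := by linarith
    have hmx := hmpos hx.le
    have hlx := hlpos hx.le
    have h1 : m y ≤ m x / (1 + (y - x) * m x) :=
      channelMMSE_sqrt_le_div hνY hx.le hxy (hx.trans_le hxy)
    have h2 : l y = l x / (1 + (y - x) * l x) := by
      have h3 : 0 < 1 + x * (v : ℝ) := by positivity
      have h4 : 1 + (y - x) * (v / (1 + x * v)) = (1 + y * v) / (1 + x * (v : ℝ)) := by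
        field_simp
        ring
      simp only [hl]
      rw [h4, div_div_div_cancel_right₀ h3.ne']
    have h3 : m y * l x ≤ m x * l y := by
      calc m y * l x ≤ m x / (1 + (y - x) * m x) * l x :=
            mul_le_mul_of_nonneg_right h1 hlx.le
        _ = m x * l x / (1 + (y - x) * m x) := by ring
        _ ≤ m x * l x / (1 + (y - x) * l x) := by
            refine div_le_div_of_nonneg_left (by positivity) (by positivity) ?_
            have := mul_le_mul_of_nonneg_left (hml hx.le) hd
            linarith
        _ = m x * l y := by rw [h2]; ring
    linarith
  have hXY : mutualInfo X Y P = ENNReal.ofReal (channelInfo (P.map X) (a / √v)) :=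
    (mutualInfo_gaussian_channel hX hX2 hM hMlaw hXM hvne a).1
  have hreach (ε : ℝ≥0) (hε : (ε : ℝ≥0∞) < mutualInfo X Y P) : ∃ x, 0 ≤ x ∧ ε < G x := by
    rw [hXY, ← ENNReal.ofReal_coe_nnreal] at hε
    have hε' := (ENNReal.ofReal_lt_ofReal_iff_of_nonneg ε.2).1 hε
    obtain ⟨s, hs0, hs⟩ := ((eventually_ge_atTop (0 : ℝ)).and
      ((tendsto_leakage hνX a hvne).eventually (lt_mem_nhds hε'))).exists
    refine ⟨s ^ 2, sq_nonneg s, ?_⟩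
    simp only [hG, Real.sqrt_sq hs0]
    exact hs
  refine ⟨fun ε hε => ?_, fun _ => ?_, fun ha => ?_⟩
  · obtain ⟨x, hx0, hx⟩ := hreach ε hε
    simp only [hrp, (hFI _).1, (hGI _).1]
    exact exists_maxGain_eq hFc hGc hG0 hGm hx0 hx
  · rw [hrp]
    have hFtop : Tendsto F atTop atTop := by
      have h1 : Tendsto (fun γ : ℝ => Real.log (1 + γ * v) / 2) atTop atTop :=
        (Real.tendsto_log_atTop.comp (tendsto_atTop_add_const_left _ 1
          (tendsto_id.atTop_mul_const hv0))).atTop_div_const two_pos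
      refine tendsto_atTop_mono' _ ?_ h1
      filter_upwards [eventually_ge_atTop 0] with γ hγ
      linarith [hGF hγ, (hGI γ).2]
    exact convexOn_maxGain hFc hGc hG0 hFtop (fun γ _ => (hFI γ).2) hF' hG'
      (fun γ hγ => half_pos (hmpos hγ.le)) hGnn hratio
  have hη : etaSq X Y P = a ^ 2 * Var[X; P] / (a ^ 2 * Var[X; P] + v) :=
    etaSq_channel hX2 hM hMlaw hXM hvne a
  set V := a ^ 2 * Var[X; P] + v with hV
  have hVX := variance_nonneg X P
  have hVpos : 0 < V := by positivity
  have hη1 : etaSq X Y P = 1 - v / V := by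
    rw [hη]; field_simp; rw [hV]; ring
  have hη0 : 0 ≤ etaSq X Y P := by rw [hη]; positivity
  have hVY : Var[id; P.map Y] = V := by
    rw [variance_map aemeasurable_id hYm.aemeasurable]
    exact variance_channel hX2 hM hMlaw hXM a
  have hm0 : m 0 = V := by
    simp only [hm, Real.sqrt_zero]
    rw [channelMMSE_zero, hVY]
  have hmmse (γ : ℝ) : mmse Y (chanOut Y N γ) P = m γ := mmse_channel hYm hY2 hN hNlaw hYN √γ
  have hmmseX {γ : ℝ} (hγ : 0 ≤ γ) : mmse Y (fun ω => (chanOut Y N γ ω, X ω)) P = l γ := by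
    have h := mmse_channel_side_info hX hX2 hM hN hMlaw hNlaw hXM hXMN a √γ
    rwa [Real.sq_sqrt hγ] at h
  -- the ratio of the two errors is smallest at `γ = 0`
  have hlm {γ : ℝ} (hγ : 0 ≤ γ) : v / V ≤ l γ / m γ := by
    have hvV : v ≤ V := by rw [hV]; nlinarith [mul_nonneg (sq_nonneg a) hVX]
    rcases hγ.eq_or_lt with rfl | hγ0
    · simp [hm0, hl]
    have h1 := channelMMSE_sqrt_le_div hνY le_rfl hγ hγ0
    have h2 : m γ ≤ V / (1 + γ * V) := by
      have h1' : m γ ≤ m 0 / (1 + (γ - 0) * m 0) := h1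
      rwa [hm0, sub_zero] at h1'
    have h3 : v / V * m γ ≤ v / V * (V / (1 + γ * V)) :=
      mul_le_mul_of_nonneg_left h2 (by positivity)
    rw [le_div_iff₀ (hmpos hγ)]
    refine h3.trans ?_
    have e : v / V * (V / (1 + γ * V)) = v / (1 + γ * V) := by field_simp
    rw [e]
    exact div_le_div_of_nonneg_left hv0.le (by positivity)
      (by linarith [mul_le_mul_of_nonneg_left hvV hγ])
  have hGηF (γ : ℝ) (hγ : 0 ≤ γ) : G γ ≤ etaSq X Y P * F γ := by
    have hd (x : ℝ) (hx : 0 < x) : HasDerivAt (fun γ => etaSq X Y P * F γ - G γ)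
        (etaSq X Y P * (m x / 2) - (m x / 2 - l x / 2)) x :=
      ((hF' x hx).const_mul _).sub (hG' x hx)
    have hmono := monotoneOn_Ici_of_hasDerivAt ((hFc.const_mul _).sub hGc) hd fun x hx => by
      have h := hlm hx.le
      rw [le_div_iff₀ (hmpos hx.le)] at h
      rw [hη1]
      linarith
    have h : etaSq X Y P * F 0 - G 0 ≤ etaSq X Y P * F γ - G γ := hmono Set.self_mem_Ici hγ hγ
    rw [hF0, hG0] at h
    linarith
  have hFpos {γ : ℝ} (hγ : 0 < γ) : 0 < F γ :=
    (half_pos (mul_pos hγ (hmpos hγ.le))).trans_le (mul_channelMMSE_le_channelInfo hνY hγ)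
  refine ⟨fun ε hε => ?_, ⟨fun γ hγ => ?_, ?_, ?_⟩, fun γ hγ => ?_, ?_, ?_⟩
  · obtain ⟨x, hx0, hx⟩ := hreach ε hε
    rw [hrp]
    exact div_le_maxGain hGc hG0 hη0 hGηF hx0 hx
  · rw [hmmse]
    exact hmpos hγ
  · rintro _ ⟨γ, hγ, rfl⟩
    simp only [hmmse, hmmseX hγ]
    rw [hη1, sub_sub_cancel]
    exact hlm hγ
  · intro b hb
    have h := hb ⟨0, Set.self_mem_Ici, rfl⟩
    simp only [hmmse, hmmseX le_rfl, hm0, hl] at h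
    rw [hη1]
    simpa using h
  · rw [(hFI γ).1]
    exact ⟨(ENNReal.ofReal_pos.2 (hFpos hγ)).ne', ENNReal.ofReal_ne_top⟩
  · rintro _ ⟨γ, hγ, rfl⟩
    have hγ' : 0 < γ := hγ
    simp only [(hFI _).1, (hGI _).1]
    refine ENNReal.div_le_of_le_mul ?_
    rw [← ENNReal.ofReal_mul hη0]
    exact ENNReal.ofReal_le_ofReal (hGηF γ hγ'.le)
  · -- an upper bound `b < 1` of the ratios yields `m ≤ v / (1 - b)`, hence `Var Y ≤ v / (1 - b)`
    intro b hb
    rcases le_or_gt 1 b with hb1 | hb1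
    · refine le_trans ?_ hb1
      rw [← ENNReal.ofReal_one]
      refine ENNReal.ofReal_le_ofReal ?_
      rw [hη1]
      linarith [div_pos hv0 hVpos]
    have hbtop : b ≠ ∞ := (hb1.trans ENNReal.one_lt_top).ne
    lift b to ℝ≥0 using hbtop
    have hb1' : (b : ℝ) < 1 := by exact_mod_cast hb1
    have hGb {γ : ℝ} (hγ : 0 < γ) : G γ ≤ b * F γ := by
      have h := hb ⟨γ, hγ, rfl⟩
      simp only [(hFI _).1, (hGI _).1] at h
      rw [ENNReal.div_le_iff (ENNReal.ofReal_pos.2 (hFpos hγ)).ne' ENNReal.ofReal_ne_top,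
        ← ENNReal.ofReal_coe_nnreal, ← ENNReal.ofReal_mul (NNReal.coe_nonneg b)] at h
      exact (ENNReal.ofReal_le_ofReal_iff (mul_nonneg b.2 (hFpos hγ).le)).1 h
    have hmb {γ : ℝ} (hγ : 0 < γ) : m γ ≤ v / (1 - b) := by
      have h1 := hGb hγ
      rw [hGF hγ.le] at h1
      have h2 : Real.log (1 + γ * v) ≤ γ * v := by
        have := Real.log_le_sub_one_of_pos (show 0 < 1 + γ * (v : ℝ) by positivity)
        linarith
      have h3 : γ * m γ / 2 ≤ F γ := mul_channelMMSE_le_channelInfo hνY hγ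
      have h4 := mul_le_mul_of_nonneg_left h3 (show 0 ≤ 1 - (b : ℝ) by linarith)
      rw [le_div_iff₀ (by linarith)]
      refine le_of_mul_le_mul_left ?_ hγ
      nlinarith
    have hVb : V ≤ v / (1 - b) := by
      rw [← hVY]
      refine variance_le_of_channelMMSE_le hνY fun s hs => ?_
      have := hmb (show 0 < s ^ 2 by positivity)
      simpa only [hm, Real.sqrt_sq hs.le] using this
    rw [ENNReal.ofReal_le_iff_le_toReal ENNReal.coe_ne_top, ENNReal.coe_toReal, hη1]
    rw [le_div_iff₀ (by linarith)] at hVb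
    have : 1 - (b : ℝ) ≤ v / V := by rw [le_div_iff₀ hVpos]; linarith
    linarith
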